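/- Let $R$ be a commutative ring and $S=R[x_1,\dots,x_m]$. **Conventions.** A *labeled cell complex* $X$ is a finite regular CW complex (possibly disconnected) with incidence numbers $\operatorname{sign}(G,F)\in\{0,\pm1\}$ and a monomial label on each vertex; a face $F$ has as label $x^{a_F}$ the least common multiple of the labels of its vertices. Its cellular free complex $\mathcal F_X$ has in degree $0$ the free $S$-module with one generator $e_C$ for each connected component $C$ of $X$ (one generator if $X=\emptyset$), in degree $i+1$ the free $S$-module on the $i$-cells, and differential $\partial e_F=\sum_G \operatorname{sign}(G,F)\,x^{a_F-a_G}e_G$ (for a vertex $v$ in the component $C$: $\partial e_v=x^{a_v}e_C$). It is a *cellular resolution* if its homology vanishes in all degrees $\ge 1$. A *morphism* $\mathcal F_X\to\mathcal F_Y$ is a pair $(\mathbf f,f)$ of an $S$-linear chain map and a cellular map $f:X\to Y$ that are compatible: $\mathbf f_0$ sends the generator of each component $C$ to a monomial times a generator, which is that of the component containing $f(C)$ when $X\neq\emptyset$, and for each $i$-cell $c$ the element $\mathbf f_{i+1}(e_c)$ is an $S$-linear combination of the generators of $i$-cells contained in $f(\bar c)$, where $\bar c$ is the closed cell. Two morphisms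 are *homotopic* ($\simeq$) if their chain maps are chain homotopic and their cellular maps are homotopic. **Proposition.** Let $\mathcal F$ be a cellular resolution supported on $X$, let $n\ge0$, let $\Delta_n$ be the $n$-simplex (with $n+1$ vertices), and let $T_n$ be the cellular free complex of $\Delta_n$ with all labels $1$. Let $P$ be the cellular free complex of $X\times\Delta_n$ with product cells, $(v,w)$ labeled like $v$, and incidence numbers given by $\partial(\sigma\times\tau)=\partial\sigma\times\tau+(-1)^{\dim\sigma}\sigma\times\partial\tau$. Then: 1. $T_n$ and $P$ are cellular resolutions. If $X$ has $a_{i+1}$ cells of dimension $i$, then $P_{i+1}$ is free on $\sum_{k=0}^{i}\binom{n+1}{k+1}a_{i+1-k}$ generators, and in degrees $\ge 2$ the matrix of the differential of $P$ consists of one copy of the matrix of $\partial^{\mathcal F}$ for each face $\tau$ of $\Delta_n$ and one copy of the boundary matrix of $\Delta_n$, multiplied by $(-1)^{\dim\sigma}$, for each cell $\sigma$ of $X$. 2. There are morphisms $(\mathbf p_1,p_1'):P\to\mathcal F$ and $(\mathbf p_2,p_2'):P\to T_n$ whose cellular maps are the topological projections, such that $\mathbf p_1$ is in degree $0$ a bijection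 of bases (the identity under the identification $P_0=\mathcal F_0$) and $\mathbf p_2$ sends each degree $0$ generator to a generator. 3. With these projections $P$ is a product of $\mathcal F$ and $T_n$ up to homotopy: for every cellular resolution $\mathcal Z$ and all morphisms $\phi:\mathcal Z\to\mathcal F$, $\psi:\mathcal Z\to T_n$ there is a morphism $h:\mathcal Z\to P$ with $p_1h\simeq\phi$ and $p_2h\simeq\psi$, and any two such morphisms are homotopic. 4. Moreover, for $\mathcal Z,\phi,\psi$ as in 3 there is a morphism $(\mathbf h,h')$ to $P$ whose cellular map $h'$ is homotopic to the topological product map $\alpha=(\phi',\psi')$ of the underlying cellular maps and with $\mathbf p_{1,0}\mathbf h_0=\boldsymbol\phi_0$; and every morphism $h$ with these two properties satisfies $p_1h\simeq\phi$ and $p_2h\simeq\psi$. -/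

import Mathlib

set_option linter.unusedSectionVars false

universe u w

open Topology Metric Set

noncomputable section

/-! ### Finite regular CW complexes -/

/-- A finite regular CW complex: a Hausdorff space with a finite CW structure (in the sense of
Mathlib) all of whose characteristic maps are injective on the *closed* ball, so that every closed
cell is homeomorphic to a closed ball. The complex may be disconnected or empty. -/
structure RegularCW : Type (u + 1) where
  carrier : Type u
  [top : TopologicalSpace carrier]
  [t2 : T2Space carrier]
  [cw : CWComplex (univ : Set carrier)]
  [fin : RelCWComplex.Finite (univ : Set carrier)]
  injOn : ∀ (n : ℕ) (i : RelCWComplex.cell (univ : Set carrier) n),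
    InjOn (RelCWComplex.map n i) (closedBall 0 1)

namespace RegularCW

attribute [instance] RegularCW.top RegularCW.t2 RegularCW.cw RegularCW.fin

variable (X Y : RegularCW.{u})

/-- The cells of all dimensions. -/
@[ext]
structure Cell : Type u where
  /-- The dimension of the cell. -/
  dim : ℕ
  /-- The cell, as an index of the CW structure. -/
  idx : RelCWComplex.cell (univ : Set X.carrier) dim

/-- The cells of all dimensions, as a sigma type. -/
def cellEquivSigma : X.Cell ≃ Σ n, RelCWComplex.cell (univ : Set X.carrier) n where
  toFun c := ⟨c.dim, c.idx⟩
  invFun c := ⟨c.1, c.2⟩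
  left_inv _ := rfl
  right_inv _ := rfl

instance : Finite X.Cell :=
  have := RelCWComplex.finite_cells_of_finite (C := (univ : Set X.carrier))
  Finite.of_equiv _ X.cellEquivSigma.symm

instance : Fintype X.Cell := Fintype.ofFinite _

variable {X Y}

/-- The closed cell, as a subset of the space. -/
def Cell.closed (c : X.Cell) : Set X.carrier := RelCWComplex.closedCell c.dim c.idx

/-- The open cell, as a subset of the space. -/
def Cell.opened (c : X.Cell) : Set X.carrier := RelCWComplex.openCell c.dim c.idx

/-- The centre of a cell; for a `0`-cell this is its only point. -/
def Cell.center (c : X.Cell) : X.carrier := RelCWComplex.map c.dim c.idx 0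

/-- `IsFacet G F`: the cell `G` is contained in the closed cell `F`, with codimension one. -/
def IsFacet (G F : X.Cell) : Prop := F.dim = G.dim + 1 ∧ G.closed ⊆ F.closed

variable (X) in
/-- The cells of dimension `n`. -/
abbrev CellOfDim (n : ℕ) : Type u := {c : X.Cell // c.dim = n}

lemma Cell.center_mem (c : X.Cell) : c.center ∈ c.closed :=
  RelCWComplex.map_zero_mem_closedCell _ _

lemma Cell.isPreconnected_closed (c : X.Cell) : IsPreconnected c.closed :=
  (convex_closedBall (0 : Fin c.dim → ℝ) 1).isPreconnected.image _ (RelCWComplex.continuousOn _ _)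

/-- A cell meeting the closed cell `c` in its own centre is `c` or has smaller dimension. -/
lemma Cell.eq_or_dim_lt {b c : X.Cell} (h : b.center ∈ c.closed) : b = c ∨ b.dim < c.dim := by
  have h' : b.center ∈ RelCWComplex.cellFrontier c.dim c.idx ∪ RelCWComplex.openCell c.dim c.idx := by
    rw [RelCWComplex.cellFrontier_union_openCell_eq_closedCell]; exact h
  have hb : b.center ∈ RelCWComplex.openCell b.dim b.idx := RelCWComplex.map_zero_mem_openCell _ _
  rcases h' with h' | h'
  · right
    obtain ⟨I, hI⟩ := CWComplex.cellFrontier_subset_finite_openCell c.dim c.idx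
    have := hI h'
    simp only [mem_iUnion] at this
    obtain ⟨m, hm, j, -, hj⟩ := this
    by_cases hbj : (⟨b.dim, b.idx⟩ : Σ n, RelCWComplex.cell (univ : Set X.carrier) n) = ⟨m, j⟩
    · have : b.dim = m := congrArg Sigma.fst hbj
      omega
    · exact absurd hj (disjoint_left.1 (RelCWComplex.disjoint_openCell_of_ne hbj) hb)
  · left
    by_contra hbc
    exact disjoint_left.1 (RelCWComplex.disjoint_openCell_of_ne
      (i := b.idx) (j := c.idx) (fun h => hbc (by cases b; cases c; cases h; rfl))) hb h'

lemma Cell.eq_or_dim_lt_of_subset {b c : X.Cell} (h : b.closed ⊆ c.closed) :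
    b = c ∨ b.dim < c.dim := Cell.eq_or_dim_lt (h b.center_mem)

/-! ### The product of two regular CW complexes -/

/-- A cube `[-1,1]^(p+q)` split into its first `p` and its last `q` coordinates. -/
def splitEquiv {p q k : ℕ} (h : p + q = k) :
    (Fin k → ℝ) ≃ (Fin p → ℝ) × (Fin q → ℝ) :=
  ((Equiv.arrowCongr (finSumFinEquiv.trans (finCongr h)) (Equiv.refl ℝ)).symm).trans
    (Equiv.sumArrowEquivProdArrow (Fin p) (Fin q) ℝ)

lemma continuous_splitEquiv {p q k : ℕ} (h : p + q = k) : Continuous (splitEquiv h) := by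
  unfold splitEquiv
  simp only [Equiv.coe_trans]
  refine Continuous.prodMk ?_ ?_ <;>
  · refine continuous_pi fun i => ?_
    exact continuous_apply _

lemma continuous_splitEquiv_symm {p q k : ℕ} (h : p + q = k) :
    Continuous (splitEquiv h).symm := by
  subst h
  refine continuous_pi fun i => ?_
  refine Fin.addCases (fun j => ?_) (fun j => ?_) i
  · have : (fun a => (splitEquiv (p := p) (q := q) rfl).symm a (Fin.castAdd q j))
        = fun a => a.1 j := by
      funext a; simp [splitEquiv, Equiv.arrowCongr, Equiv.sumArrowEquivProdArrow]
    rw [this]; fun_prop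
  · have : (fun a => (splitEquiv (p := p) (q := q) rfl).symm a (Fin.natAdd p j))
        = fun a => a.2 j := by
      funext a; simp [splitEquiv, Equiv.arrowCongr, Equiv.sumArrowEquivProdArrow]
    rw [this]; fun_prop

lemma norm_splitEquiv {p q k : ℕ} (h : p + q = k) (y : Fin k → ℝ) :
    ‖splitEquiv h y‖ = ‖y‖ := by
  subst h
  apply le_antisymm
  · refine max_le ?_ ?_ <;>
    · refine (pi_norm_le_iff_of_nonneg (norm_nonneg _)).2 fun i => ?_
      exact norm_le_pi_norm y _
  · refine (pi_norm_le_iff_of_nonneg (norm_nonneg _)).2 fun i => ?_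
    refine Fin.addCases (fun j => ?_) (fun j => ?_) i
    · exact (norm_le_pi_norm (splitEquiv rfl y).1 j).trans (le_max_left _ _)
    · exact (norm_le_pi_norm (splitEquiv rfl y).2 j).trans (le_max_right _ _)

lemma splitEquiv_mem_closedBall {p q k : ℕ} (h : p + q = k) (y : Fin k → ℝ) :
    y ∈ closedBall (0 : Fin k → ℝ) 1 ↔
      (splitEquiv h y).1 ∈ closedBall (0 : Fin p → ℝ) 1 ∧
      (splitEquiv h y).2 ∈ closedBall (0 : Fin q → ℝ) 1 := by
  simp only [mem_closedBall_zero_iff, ← norm_splitEquiv h y, Prod.norm_def, max_le_iff]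

lemma splitEquiv_mem_ball {p q k : ℕ} (h : p + q = k) (y : Fin k → ℝ) :
    y ∈ ball (0 : Fin k → ℝ) 1 ↔
      (splitEquiv h y).1 ∈ ball (0 : Fin p → ℝ) 1 ∧
      (splitEquiv h y).2 ∈ ball (0 : Fin q → ℝ) 1 := by
  simp only [mem_ball_zero_iff, ← norm_splitEquiv h y, Prod.norm_def, max_lt_iff]

variable (X Y) in
/-- The `k`-cells of the product: pairs of a cell of `X` and a cell of `Y` whose dimensions add up
to `k`. -/
@[ext]
structure ProdCell (k : ℕ) : Type u where
  left : X.Cell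
  right : Y.Cell
  dim_add : left.dim + right.dim = k

/-- The characteristic map of a product cell: the product of the two characteristic maps. -/
def prodMap (k : ℕ) (c : ProdCell X Y k) :
    PartialEquiv (Fin k → ℝ) (X.carrier × Y.carrier) :=
  (splitEquiv c.dim_add).toPartialEquiv.trans
    ((RelCWComplex.map c.left.dim c.left.idx).prod (RelCWComplex.map c.right.dim c.right.idx))

lemma prodMap_apply {k : ℕ} (c : ProdCell X Y k) (y : Fin k → ℝ) :
    prodMap k c y = (RelCWComplex.map c.left.dim c.left.idx (splitEquiv c.dim_add y).1,
      RelCWComplex.map c.right.dim c.right.idx (splitEquiv c.dim_add y).2) := rfl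

lemma prodMap_image_closedBall {k : ℕ} (c : ProdCell X Y k) :
    prodMap k c '' closedBall 0 1 = c.left.closed ×ˢ c.right.closed := by
  ext ⟨a, b⟩
  constructor
  · rintro ⟨y, hy, hyab⟩
    rw [prodMap_apply] at hyab
    obtain ⟨h1, h2⟩ := (splitEquiv_mem_closedBall c.dim_add y).1 hy
    simp only [Prod.mk.injEq] at hyab
    exact ⟨⟨_, h1, hyab.1⟩, ⟨_, h2, hyab.2⟩⟩
  · rintro ⟨⟨y, hy, rfl⟩, ⟨z, hz, rfl⟩⟩
    refine ⟨(splitEquiv c.dim_add).symm (y, z), ?_, ?_⟩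
    · rw [splitEquiv_mem_closedBall c.dim_add]; rw [Equiv.apply_symm_apply]; exact ⟨hy, hz⟩
    · rw [prodMap_apply]; simp

lemma prodMap_image_ball {k : ℕ} (c : ProdCell X Y k) :
    prodMap k c '' ball 0 1 = c.left.opened ×ˢ c.right.opened := by
  ext ⟨a, b⟩
  constructor
  · rintro ⟨y, hy, hyab⟩
    rw [prodMap_apply] at hyab
    obtain ⟨h1, h2⟩ := (splitEquiv_mem_ball c.dim_add y).1 hy
    simp only [Prod.mk.injEq] at hyab
    exact ⟨⟨_, h1, hyab.1⟩, ⟨_, h2, hyab.2⟩⟩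
  · rintro ⟨⟨y, hy, rfl⟩, ⟨z, hz, rfl⟩⟩
    refine ⟨(splitEquiv c.dim_add).symm (y, z), ?_, ?_⟩
    · rw [splitEquiv_mem_ball c.dim_add]; rw [Equiv.apply_symm_apply]; exact ⟨hy, hz⟩
    · rw [prodMap_apply]; simp

lemma prodMap_source {k : ℕ} (c : ProdCell X Y k) : (prodMap k c).source = ball 0 1 := by
  ext y
  rw [splitEquiv_mem_ball c.dim_add]
  simp [prodMap, RelCWComplex.source_eq]

lemma prodMap_continuousOn {k : ℕ} (c : ProdCell X Y k) :
    ContinuousOn (prodMap k c) (closedBall 0 1) := by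
  have h := continuous_splitEquiv c.dim_add
  refine ContinuousOn.prodMk ?_ ?_
  · exact (RelCWComplex.continuousOn c.left.dim c.left.idx).comp (continuous_fst.comp h).continuousOn
      fun y hy => ((splitEquiv_mem_closedBall c.dim_add y).1 hy).1
  · exact (RelCWComplex.continuousOn c.right.dim c.right.idx).comp (continuous_snd.comp h).continuousOn
      fun y hy => ((splitEquiv_mem_closedBall c.dim_add y).1 hy).2

lemma prodMap_continuousOn_symm {k : ℕ} (c : ProdCell X Y k) :
    ContinuousOn (prodMap k c).symm (prodMap k c).target := by
  have ht : (prodMap k c).target ⊆ (RelCWComplex.map c.left.dim c.left.idx).target ×ˢ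
      (RelCWComplex.map c.right.dim c.right.idx).target := by
    intro z hz
    simpa [prodMap] using hz
  refine (continuous_splitEquiv_symm c.dim_add).comp_continuousOn (ContinuousOn.prodMk ?_ ?_)
  · exact (RelCWComplex.continuousOn_symm c.left.dim c.left.idx).comp continuous_fst.continuousOn
      fun z hz => (ht hz).1
  · exact (RelCWComplex.continuousOn_symm c.right.dim c.right.idx).comp continuous_snd.continuousOn
      fun z hz => (ht hz).2

lemma prodMap_injOn {k : ℕ} (c : ProdCell X Y k) : InjOn (prodMap k c) (closedBall 0 1) := by
  intro y hy z hz h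
  rw [prodMap_apply, prodMap_apply, Prod.mk.injEq] at h
  obtain ⟨hy1, hy2⟩ := (splitEquiv_mem_closedBall c.dim_add y).1 hy
  obtain ⟨hz1, hz2⟩ := (splitEquiv_mem_closedBall c.dim_add z).1 hz
  exact (splitEquiv c.dim_add).injective
    (Prod.ext (X.injOn _ _ hy1 hz1 h.1) (Y.injOn _ _ hy2 hz2 h.2))

instance (k : ℕ) : Finite (ProdCell X Y k) :=
  Finite.of_injective (fun c => (c.left, c.right)) fun _ _ h =>
    ProdCell.ext (congrArg Prod.fst h) (congrArg Prod.snd h)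

lemma prodCell_eventually_isEmpty : ∀ᶠ k in Filter.atTop, IsEmpty (ProdCell X Y k) := by
  have hf : Finite (X.Cell × Y.Cell) := inferInstance
  have hb : (Set.range fun p : X.Cell × Y.Cell => p.1.dim + p.2.dim).Finite := Set.finite_range _
  obtain ⟨N, hN⟩ := hb.bddAbove
  filter_upwards [Filter.eventually_gt_atTop N] with k hk
  refine ⟨fun c => ?_⟩
  have := hN ⟨(c.left, c.right), rfl⟩
  have := c.dim_add
  simp only at *
  omega

lemma prodMap_pairwiseDisjoint :
    (univ : Set (Σ k, ProdCell X Y k)).PairwiseDisjoint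
      (fun c => prodMap c.1 c.2 '' ball 0 1) := by
  rintro ⟨k, ⟨a, b, hab⟩⟩ - ⟨l, ⟨a', b', hab'⟩⟩ - hne
  simp only [Function.onFun, prodMap_image_ball]
  rw [Set.disjoint_prod]
  by_contra hcon
  rw [not_or] at hcon
  apply hne
  have h1 : a = a' := by
    by_contra hne'
    exact hcon.1 (RelCWComplex.disjoint_openCell_of_ne (i := a.idx) (j := a'.idx)
      (fun h => hne' (by cases a; cases a'; cases h; rfl)))
  have h2 : b = b' := by
    by_contra hne'
    exact hcon.2 (RelCWComplex.disjoint_openCell_of_ne (i := b.idx) (j := b'.idx)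
      (fun h => hne' (by cases b; cases b'; cases h; rfl)))
  subst h1 h2
  have hk : k = l := hab.symm.trans hab'
  subst hk
  rfl

lemma cellFrontier_subset (c : X.Cell) {x : X.carrier}
    (hx : x ∈ RelCWComplex.cellFrontier c.dim c.idx) :
    ∃ b : X.Cell, b.dim < c.dim ∧ x ∈ b.closed := by
  obtain ⟨I, hI⟩ := CWComplex.cellFrontier_subset_finite_closedCell c.dim c.idx
  have := hI hx
  simp only [mem_iUnion] at this
  obtain ⟨m, hm, j, -, hj⟩ := this
  exact ⟨⟨m, j⟩, hm, hj⟩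

lemma prodMap_mapsTo (k : ℕ) (c : ProdCell X Y k) :
    MapsTo (prodMap k c) (sphere 0 1)
      (⋃ (m < k) (j : ProdCell X Y m), prodMap m j '' closedBall 0 1) := by
  intro y hy
  have hcl : y ∈ closedBall (0 : Fin k → ℝ) 1 := sphere_subset_closedBall hy
  obtain ⟨h1, h2⟩ := (splitEquiv_mem_closedBall c.dim_add y).1 hcl
  have hnorm : max ‖(splitEquiv c.dim_add y).1‖ ‖(splitEquiv c.dim_add y).2‖ = 1 := by
    rw [← Prod.norm_def, norm_splitEquiv]; simpa using hy
  have hsum := c.dim_add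
  simp only [mem_iUnion]
  rcases max_choice ‖(splitEquiv c.dim_add y).1‖ ‖(splitEquiv c.dim_add y).2‖ with hm | hm
  · obtain ⟨b, hb, hxb⟩ := cellFrontier_subset c.left
      (x := RelCWComplex.map c.left.dim c.left.idx (splitEquiv c.dim_add y).1)
      ⟨_, by rw [mem_sphere_zero_iff_norm]; rw [hm] at hnorm; exact hnorm, rfl⟩
    refine ⟨b.dim + c.right.dim, by omega, ⟨b, c.right, rfl⟩, ?_⟩
    rw [prodMap_image_closedBall]
    exact ⟨hxb, ⟨_, h2, rfl⟩⟩
  · obtain ⟨b, hb, hxb⟩ := cellFrontier_subset c.right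
      (x := RelCWComplex.map c.right.dim c.right.idx (splitEquiv c.dim_add y).2)
      ⟨_, by rw [mem_sphere_zero_iff_norm]; rw [hm] at hnorm; exact hnorm, rfl⟩
    refine ⟨c.left.dim + b.dim, by omega, ⟨c.left, b, rfl⟩, ?_⟩
    rw [prodMap_image_closedBall]
    exact ⟨⟨_, h1, rfl⟩, hxb⟩

lemma exists_mem_closed (x : X.carrier) : ∃ c : X.Cell, x ∈ c.closed := by
  have := mem_univ x
  rw [← CWComplex.union (C := (univ : Set X.carrier))] at this
  simp only [mem_iUnion] at this
  obtain ⟨n, j, h⟩ := this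
  exact ⟨⟨n, j⟩, h⟩

lemma prodMap_union :
    ⋃ (k : ℕ) (c : ProdCell X Y k), prodMap k c '' closedBall 0 1 = univ := by
  refine eq_univ_of_forall fun z => ?_
  obtain ⟨a, ha⟩ := exists_mem_closed z.1
  obtain ⟨b, hb⟩ := exists_mem_closed z.2
  simp only [mem_iUnion]
  refine ⟨_, ⟨a, b, rfl⟩, ?_⟩
  rw [prodMap_image_closedBall]
  exact ⟨ha, hb⟩

instance prodCW : CWComplex (univ : Set (X.carrier × Y.carrier)) :=
  CWComplex.mkFinite univ (ProdCell X Y) prodMap prodCell_eventually_isEmpty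
    (fun _ => inferInstance) (fun _ c => prodMap_source c) (fun _ c => prodMap_continuousOn c)
    (fun _ c => prodMap_continuousOn_symm c) prodMap_pairwiseDisjoint prodMap_mapsTo prodMap_union

variable (X Y) in
/-- The product of two regular CW complexes, with the product topology. -/
def prod : RegularCW.{u} where
  carrier := X.carrier × Y.carrier
  cw := prodCW
  fin := CWComplex.finite_mkFinite univ (ProdCell X Y) prodMap prodCell_eventually_isEmpty
    (fun _ => inferInstance) (fun _ c => prodMap_source c) (fun _ c => prodMap_continuousOn c)
    (fun _ c => prodMap_continuousOn_symm c) prodMap_pairwiseDisjoint prodMap_mapsTo prodMap_union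
  injOn _ c := prodMap_injOn c

/-- The cells of the product are the pairs of cells. -/
def prodCellEquiv : (X.prod Y).Cell ≃ X.Cell × Y.Cell where
  toFun c := ((c.idx : ProdCell X Y c.dim).left, (c.idx : ProdCell X Y c.dim).right)
  invFun p := ⟨p.1.dim + p.2.dim, (⟨p.1, p.2, rfl⟩ : ProdCell X Y _)⟩
  left_inv := by
    rintro ⟨k, ⟨a, b, hp⟩⟩
    subst hp
    rfl
  right_inv _ := rfl

lemma dim_prod (c : (X.prod Y).Cell) :
    c.dim = (prodCellEquiv c).1.dim + (prodCellEquiv c).2.dim :=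
  (c.idx : ProdCell X Y c.dim).dim_add.symm

lemma closed_prod (c : (X.prod Y).Cell) :
    c.closed = (prodCellEquiv c).1.closed ×ˢ (prodCellEquiv c).2.closed :=
  prodMap_image_closedBall (c.idx : ProdCell X Y c.dim)

lemma closed_prod_subset_iff (b c : (X.prod Y).Cell) : b.closed ⊆ c.closed ↔
    (prodCellEquiv b).1.closed ⊆ (prodCellEquiv c).1.closed ∧
      (prodCellEquiv b).2.closed ⊆ (prodCellEquiv c).2.closed := by
  rw [closed_prod, closed_prod]
  constructor
  · intro h
    exact ⟨fun x hx => (h (a := (x, _)) ⟨hx, (prodCellEquiv b).2.center_mem⟩).1,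
      fun y hy => (h (a := (_, y)) ⟨(prodCellEquiv b).1.center_mem, hy⟩).2⟩
  · rintro ⟨h1, h2⟩ x hx
    exact ⟨h1 hx.1, h2 hx.2⟩

end RegularCW

/-! ### The simplex as a regular CW complex -/

section Simplex

/-- The open solid `{y > 0, ∑ y < 1}` in `ℝᵏ`. -/
def openCorner (k : ℕ) : Set (Fin k → ℝ) := {y | (∀ i, 0 < y i) ∧ ∑ i, y i < 1}

/-- The closed solid `{y ≥ 0, ∑ y ≤ 1}` in `ℝᵏ`. -/
def closedCorner (k : ℕ) : Set (Fin k → ℝ) := {y | (∀ i, 0 ≤ y i) ∧ ∑ i, y i ≤ 1}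

lemma isOpen_openCorner (k : ℕ) : IsOpen (openCorner k) := by
  have h : openCorner k = (⋂ i, {y | 0 < y i}) ∩ {y | ∑ i, y i < 1} := by
    ext y; simp [openCorner]
  rw [h]
  exact (isOpen_iInter_of_finite fun i => isOpen_lt continuous_const (continuous_apply i)).inter
    (isOpen_lt (by fun_prop) continuous_const)

lemma isClosed_closedCorner (k : ℕ) : IsClosed (closedCorner k) := by
  have h : closedCorner k = (⋂ i, {y | 0 ≤ y i}) ∩ {y | ∑ i, y i ≤ 1} := by
    ext y; simp [closedCorner]
  rw [h]
  exact (isClosed_iInter fun i => isClosed_le continuous_const (continuous_apply i)).inter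
    (isClosed_le (by fun_prop) continuous_const)

lemma center_mem_openCorner (k : ℕ) :
    (fun _ => ((k : ℝ) + 1)⁻¹ : Fin k → ℝ) ∈ openCorner k := by
  have hk : (0 : ℝ) < (k : ℝ) + 1 := by positivity
  refine ⟨fun _ => inv_pos.2 hk, ?_⟩
  simp only [Finset.sum_const, Finset.card_univ, Fintype.card_fin, nsmul_eq_mul]
  rw [← div_eq_mul_inv, div_lt_one hk]
  linarith

lemma closure_openCorner (k : ℕ) : closure (openCorner k) = closedCorner k := by
  apply subset_antisymm
  · exact closure_minimal (fun y hy => ⟨fun i => (hy.1 i).le, hy.2.le⟩) (isClosed_closedCorner k)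
  · intro y hy
    have hc := center_mem_openCorner k
    refine closure_mono ?_ (segment_subset_closure_openSegment
      (left_mem_segment ℝ y (fun _ => ((k : ℝ) + 1)⁻¹ : Fin k → ℝ)))
    rintro z ⟨a, b, ha, hb, hab, rfl⟩
    refine ⟨fun i => ?_, ?_⟩
    · have := hy.1 i
      have := hc.1 i
      simp only [Pi.add_apply, Pi.smul_apply, smul_eq_mul]
      positivity
    · have h1 := mul_le_mul_of_nonneg_left hy.2 ha.le
      have h2 := mul_lt_mul_of_pos_left hc.2 hb
      simp only [Pi.add_apply, Pi.smul_apply, smul_eq_mul, Finset.sum_add_distrib,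
        ← Finset.mul_sum]
      linarith

lemma convex_openCorner (k : ℕ) : Convex ℝ (openCorner k) := by
  rw [convex_iff_openSegment_subset]
  rintro y hy z hz x ⟨a, b, ha, hb, hab, rfl⟩
  refine ⟨fun i => ?_, ?_⟩
  · have := hy.1 i
    have := hz.1 i
    simp only [Pi.add_apply, Pi.smul_apply, smul_eq_mul]
    positivity
  · have h1 := mul_lt_mul_of_pos_left hy.2 ha
    have h2 := mul_lt_mul_of_pos_left hz.2 hb
    simp only [Pi.add_apply, Pi.smul_apply, smul_eq_mul, Finset.sum_add_distrib,
      ← Finset.mul_sum]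
    linarith

lemma isBounded_openCorner (k : ℕ) : Bornology.IsBounded (openCorner k) := by
  refine (isBounded_closedBall (x := (0 : Fin k → ℝ)) (r := 1)).subset fun y hy => ?_
  rw [mem_closedBall_zero_iff, pi_norm_le_iff_of_nonneg zero_le_one]
  intro i
  rw [Real.norm_of_nonneg (hy.1 i).le]
  exact (Finset.single_le_sum (fun j _ => (hy.1 j).le) (Finset.mem_univ i)).trans hy.2.le

lemma exists_cornerHomeo (k : ℕ) : ∃ h : (Fin k → ℝ) ≃ₜ (Fin k → ℝ),
    h '' openCorner k = ball 0 1 ∧ h '' closedCorner k = closedBall 0 1 := by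
  have hi := (isOpen_openCorner k).interior_eq
  obtain ⟨h, h1, h2, -⟩ := exists_homeomorph_image_interior_closure_frontier_eq_unitBall
    (convex_openCorner k) (by rw [hi]; exact ⟨_, center_mem_openCorner k⟩) (isBounded_openCorner k)
  rw [hi] at h1
  rw [closure_openCorner] at h2
  exact ⟨h, h1, h2⟩

/-- A homeomorphism of `ℝᵏ` carrying the corner simplex `{y ≥ 0, ∑ y ≤ 1}` onto the closed unit ball
and its interior onto the open unit ball. -/
def cornerHomeo (k : ℕ) : (Fin k → ℝ) ≃ₜ (Fin k → ℝ) := (exists_cornerHomeo k).choose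

lemma cornerHomeo_symm_mem_open {k : ℕ} {y : Fin k → ℝ} :
    (cornerHomeo k).symm y ∈ openCorner k ↔ y ∈ ball (0 : Fin k → ℝ) 1 := by
  rw [← (exists_cornerHomeo k).choose_spec.1]
  refine ⟨fun h => ⟨_, h, (cornerHomeo k).apply_symm_apply y⟩, ?_⟩
  rintro ⟨z, hz, rfl⟩
  exact ((cornerHomeo k).symm_apply_apply z).symm ▸ hz

lemma cornerHomeo_symm_mem_closed {k : ℕ} {y : Fin k → ℝ} :
    (cornerHomeo k).symm y ∈ closedCorner k ↔ y ∈ closedBall (0 : Fin k → ℝ) 1 := by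
  rw [← (exists_cornerHomeo k).choose_spec.2]
  refine ⟨fun h => ⟨_, h, (cornerHomeo k).apply_symm_apply y⟩, ?_⟩
  rintro ⟨z, hz, rfl⟩
  exact ((cornerHomeo k).symm_apply_apply z).symm ▸ hz

variable (V : Type u) [LinearOrder V] [Fintype V]

/-- The `k`-dimensional faces of the simplex with vertex set `V`: the sets of `k + 1` vertices. -/
@[ext]
structure Face (k : ℕ) : Type u where
  verts : Finset V
  card_eq : verts.card = k + 1

instance (k : ℕ) : Finite (Face V k) := Finite.of_injective Face.verts fun _ _ => Face.ext

variable {V}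

namespace Face

variable {k : ℕ} (s : Face V k)

/-- The vertices of a face in increasing order. -/
def vertex : Fin (k + 1) ↪o V := s.verts.orderEmbOfFin s.card_eq

lemma vertex_mem (i : Fin (k + 1)) : s.vertex i ∈ s.verts := s.verts.orderEmbOfFin_mem s.card_eq i

lemma exists_vertex {v : V} (hv : v ∈ s.verts) : ∃ i, s.vertex i = v := by
  have : v ∈ Set.range (s.verts.orderEmbOfFin s.card_eq) := by
    rw [Finset.range_orderEmbOfFin]; exact hv
  exact this

/-- Barycentric coordinates on a face: the point with coordinates `1 - ∑ y, y₀, …, y_{k-1}` at the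
vertices of the face and `0` elsewhere. -/
def point (y : Fin k → ℝ) : V → ℝ :=
  Function.extend s.vertex (Fin.cons (1 - ∑ j, y j) y : Fin (k + 1) → ℝ) 0

lemma point_vertex (y : Fin k → ℝ) (i : Fin (k + 1)) :
    s.point y (s.vertex i) = (Fin.cons (1 - ∑ j, y j) y : Fin (k + 1) → ℝ) i :=
  s.vertex.injective.extend_apply _ _ _

lemma point_of_notMem (y : Fin k → ℝ) {v : V} (hv : v ∉ s.verts) : s.point y v = 0 :=
  Function.extend_apply' _ _ _ (by rintro ⟨i, rfl⟩; exact hv (s.vertex_mem i))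

lemma sum_verts (x : V → ℝ) (hx : ∀ v, v ∉ s.verts → x v = 0) :
    ∑ v, x v = ∑ i, x (s.vertex i) := by
  rw [← Finset.sum_subset (Finset.subset_univ s.verts) fun v _ hv => hx v hv]
  conv_lhs => rw [← Finset.map_orderEmbOfFin_univ s.verts s.card_eq]
  rw [Finset.sum_map]
  rfl

lemma sum_point (y : Fin k → ℝ) : ∑ v, s.point y v = 1 := by
  rw [s.sum_verts _ fun v hv => s.point_of_notMem y hv]
  simp only [point_vertex, Fin.sum_univ_succ, Fin.cons_zero, Fin.cons_succ]
  ring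

lemma point_mem {y : Fin k → ℝ} (hy : y ∈ closedCorner k) : s.point y ∈ stdSimplex ℝ V := by
  refine ⟨fun v => ?_, s.sum_point y⟩
  by_cases hv : v ∈ s.verts
  · obtain ⟨i, rfl⟩ := s.exists_vertex hv
    rw [point_vertex]
    refine Fin.cases ?_ (fun j => ?_) i
    · simpa using hy.2
    · simpa using hy.1 j
  · rw [s.point_of_notMem y hv]

lemma point_pos {y : Fin k → ℝ} (hy : y ∈ openCorner k) (v : V) :
    s.point y v ≠ 0 ↔ v ∈ s.verts := by
  by_cases hv : v ∈ s.verts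
  · obtain ⟨i, rfl⟩ := s.exists_vertex hv
    refine iff_of_true ?_ hv
    rw [point_vertex]
    refine Fin.cases ?_ (fun j => ?_) i
    · have := hy.2
      simp only [Fin.cons_zero]
      linarith
    · simpa using (hy.1 j).ne'
  · exact iff_of_false (fun h => h (s.point_of_notMem y hv)) hv

/-- The coordinates of a point of the simplex at all but the first vertex of the face. -/
def coords (x : V → ℝ) : Fin k → ℝ := fun i => x (s.vertex i.succ)

lemma coords_point (y : Fin k → ℝ) : s.coords (s.point y) = y := by
  funext i
  rw [coords, point_vertex, Fin.cons_succ]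

lemma sum_coords {x : V → ℝ} (hx : x ∈ stdSimplex ℝ V) (hs : ∀ v, v ∉ s.verts → x v = 0) :
    x (s.vertex 0) = 1 - ∑ j, s.coords x j := by
  have h := s.sum_verts x hs
  rw [hx.2, Fin.sum_univ_succ] at h
  simp only [coords]
  linarith

lemma point_coords {x : V → ℝ} (hx : x ∈ stdSimplex ℝ V) (hs : ∀ v, v ∉ s.verts → x v = 0) :
    s.point (s.coords x) = x := by
  funext v
  by_cases hv : v ∈ s.verts
  · obtain ⟨i, rfl⟩ := s.exists_vertex hv
    rw [point_vertex]
    refine Fin.cases ?_ (fun j => ?_) i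
    · rw [Fin.cons_zero, s.sum_coords hx hs]
    · rw [Fin.cons_succ]; rfl
  · rw [s.point_of_notMem _ hv, hs v hv]

lemma coords_mem_closed {x : V → ℝ} (hx : x ∈ stdSimplex ℝ V)
    (hs : ∀ v, v ∉ s.verts → x v = 0) : s.coords x ∈ closedCorner k := by
  refine ⟨fun i => hx.1 _, ?_⟩
  have := s.sum_coords hx hs
  have := hx.1 (s.vertex 0)
  linarith

lemma coords_mem_open {x : V → ℝ} (hx : x ∈ stdSimplex ℝ V)
    (hs : ∀ v, x v ≠ 0 ↔ v ∈ s.verts) : s.coords x ∈ openCorner k := by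
  have hpos : ∀ i, 0 < x (s.vertex i) := fun i =>
    lt_of_le_of_ne (hx.1 _) ((hs _).2 (s.vertex_mem i)).symm
  refine ⟨fun i => hpos _, ?_⟩
  have := s.sum_coords hx (fun v hv => by by_contra h; exact hv ((hs v).1 h))
  have := hpos 0
  linarith

lemma openCorner_subset : openCorner k ⊆ closedCorner k :=
  fun _ hy => ⟨fun i => (hy.1 i).le, hy.2.le⟩

lemma zero_mem_closedCorner : (0 : Fin k → ℝ) ∈ closedCorner k := by
  refine ⟨fun _ => le_rfl, ?_⟩
  simp

open Classical in
/-- The characteristic map of a face (constant outside of the closed ball). -/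
def charFun (y : Fin k → ℝ) : stdSimplex ℝ V :=
  if h : (cornerHomeo k).symm y ∈ closedCorner k then ⟨s.point _, s.point_mem h⟩
  else ⟨s.point _, s.point_mem zero_mem_closedCorner⟩

lemma charFun_coe {y : Fin k → ℝ} (hy : y ∈ closedBall (0 : Fin k → ℝ) 1) :
    (s.charFun y).1 = s.point ((cornerHomeo k).symm y) := by
  rw [charFun, dif_pos (cornerHomeo_symm_mem_closed.2 hy)]

/-- The inverse of the characteristic map of a face. -/
def charInv (x : stdSimplex ℝ V) : Fin k → ℝ := cornerHomeo k (s.coords x.1)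

lemma charInv_charFun {y : Fin k → ℝ} (hy : y ∈ closedBall (0 : Fin k → ℝ) 1) :
    s.charInv (s.charFun y) = y := by
  rw [charInv, s.charFun_coe hy, coords_point, Homeomorph.apply_symm_apply]

lemma charInv_mem {x : stdSimplex ℝ V} (hs : ∀ v, v ∉ s.verts → x.1 v = 0) :
    s.charInv x ∈ closedBall (0 : Fin k → ℝ) 1 := by
  rw [← cornerHomeo_symm_mem_closed, charInv, Homeomorph.symm_apply_apply]
  exact s.coords_mem_closed x.2 hs

lemma charInv_mem_ball {x : stdSimplex ℝ V} (hs : ∀ v, x.1 v ≠ 0 ↔ v ∈ s.verts) :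
    s.charInv x ∈ ball (0 : Fin k → ℝ) 1 := by
  rw [← cornerHomeo_symm_mem_open, charInv, Homeomorph.symm_apply_apply]
  exact s.coords_mem_open x.2 hs

lemma charFun_charInv {x : stdSimplex ℝ V} (hs : ∀ v, v ∉ s.verts → x.1 v = 0) :
    s.charFun (s.charInv x) = x := by
  apply Subtype.ext
  rw [s.charFun_coe (s.charInv_mem hs), charInv, Homeomorph.symm_apply_apply,
    s.point_coords x.2 hs]

/-- The characteristic map of a face as a partial equivalence. -/
def charMap : PartialEquiv (Fin k → ℝ) (stdSimplex ℝ V) where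
  toFun := s.charFun
  invFun := s.charInv
  source := ball 0 1
  target := {x : stdSimplex ℝ V | ∀ v, x.1 v ≠ 0 ↔ v ∈ s.verts}
  map_source' y hy v := by
    rw [s.charFun_coe (ball_subset_closedBall hy)]
    exact s.point_pos (cornerHomeo_symm_mem_open.2 hy) v
  map_target' x hx := s.charInv_mem_ball hx
  left_inv' y hy := s.charInv_charFun (ball_subset_closedBall hy)
  right_inv' x hx := s.charFun_charInv fun v hv => by
    by_contra h
    exact hv ((hx v).1 h)

lemma charMap_continuousOn : ContinuousOn s.charMap (closedBall 0 1) := by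
  rw [Topology.IsInducing.subtypeVal.continuousOn_iff]
  have h : Continuous fun y => s.point ((cornerHomeo k).symm y) := by
    refine continuous_pi fun v => ?_
    by_cases hv : v ∈ s.verts
    · obtain ⟨i, rfl⟩ := s.exists_vertex hv
      simp only [point_vertex]
      refine Fin.cases ?_ (fun j => ?_) i
      · simp only [Fin.cons_zero]; fun_prop
      · simp only [Fin.cons_succ]; fun_prop
    · simp only [s.point_of_notMem _ hv]; fun_prop
  exact h.continuousOn.congr fun y hy => s.charFun_coe hy

lemma charMap_continuousOn_symm : ContinuousOn s.charMap.symm s.charMap.target := by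
  refine Continuous.continuousOn ((cornerHomeo k).continuous.comp (continuous_pi fun i => ?_))
  exact (continuous_apply (s.vertex i.succ)).comp continuous_subtype_val

lemma charMap_injOn : InjOn s.charMap (closedBall 0 1) := fun y hy z hz h => by
  rw [← s.charInv_charFun hy, ← s.charInv_charFun hz]
  exact congrArg s.charInv h

lemma charMap_image_ball :
    s.charMap '' ball 0 1 = {x : stdSimplex ℝ V | ∀ v, x.1 v ≠ 0 ↔ v ∈ s.verts} :=
  s.charMap.image_source_eq_target

lemma charMap_image_closedBall :
    s.charMap '' closedBall 0 1 = {x : stdSimplex ℝ V | ∀ v, v ∉ s.verts → x.1 v = 0} := by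
  ext x
  constructor
  · rintro ⟨y, hy, rfl⟩ v hv
    show (s.charFun y).1 v = 0
    rw [s.charFun_coe hy, s.point_of_notMem _ hv]
  · intro hx
    exact ⟨_, s.charInv_mem hx, s.charFun_charInv hx⟩

lemma eventually_isEmpty : ∀ᶠ k in Filter.atTop, IsEmpty (Face V k) := by
  filter_upwards [Filter.eventually_ge_atTop (Fintype.card V)] with k hk
  refine ⟨fun s => ?_⟩
  have h1 := s.card_eq
  have h2 := Finset.card_le_univ s.verts
  omega

lemma charMap_pairwiseDisjoint :
    (univ : Set (Σ k, Face V k)).PairwiseDisjoint (fun c => c.2.charMap '' ball 0 1) := by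
  rintro ⟨k, ⟨s, hs⟩⟩ - ⟨l, ⟨t, ht⟩⟩ - hne
  rw [Function.onFun, charMap_image_ball, charMap_image_ball, Set.disjoint_left]
  intro x hx hx'
  apply hne
  have hst : s = t := Finset.ext fun v => (hx v).symm.trans (hx' v)
  subst hst
  have : k = l := by omega
  subst this
  rfl

open Classical in
/-- The smallest face containing a point. -/
lemma exists_face (x : stdSimplex ℝ V) :
    ∃ (k : ℕ) (t : Face V k), ∀ v, x.1 v ≠ 0 ↔ v ∈ t.verts := by
  have hne : (Finset.univ.filter fun v => x.1 v ≠ 0).Nonempty := by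
    by_contra h
    rw [Finset.not_nonempty_iff_eq_empty, Finset.filter_eq_empty_iff] at h
    have h1 := x.2.2
    rw [Finset.sum_eq_zero fun v hv => not_not.1 (h hv)] at h1
    exact zero_ne_one h1
  exact ⟨_, ⟨_, (Nat.succ_pred_eq_of_pos hne.card_pos).symm⟩, fun v => by simp⟩

lemma charMap_mapsTo (k : ℕ) (s : Face V k) :
    MapsTo s.charMap (sphere 0 1)
      (⋃ (m < k) (t : Face V m), t.charMap '' closedBall 0 1) := by
  intro y hy
  have hyc : y ∈ closedBall (0 : Fin k → ℝ) 1 := sphere_subset_closedBall hy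
  have hyb : y ∉ ball (0 : Fin k → ℝ) 1 := by
    rw [mem_sphere] at hy
    rw [mem_ball, hy]
    exact lt_irrefl _
  obtain ⟨m, t, ht⟩ := exists_face (s.charMap y)
  have hts : t.verts ⊆ s.verts := fun v hv => by
    by_contra hvs
    apply (ht v).2 hv
    show (s.charFun y).1 v = 0
    rw [s.charFun_coe hyc, s.point_of_notMem _ hvs]
  have hne : t.verts ≠ s.verts := fun h => by
    apply hyb
    rw [← s.charInv_charFun hyc]
    refine s.charInv_mem_ball fun v => ?_
    rw [← h]
    exact ht v
  have hlt := Finset.card_lt_card (Finset.ssubset_iff_subset_ne.2 ⟨hts, hne⟩)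
  rw [t.card_eq, s.card_eq] at hlt
  simp only [mem_iUnion]
  refine ⟨m, by omega, t, ?_⟩
  rw [charMap_image_closedBall]
  intro v hv
  by_contra h
  exact hv ((ht v).1 h)

lemma charMap_union : ⋃ (k : ℕ) (s : Face V k), s.charMap '' closedBall 0 1 = univ := by
  refine eq_univ_of_forall fun x => ?_
  obtain ⟨m, t, ht⟩ := exists_face x
  simp only [mem_iUnion]
  refine ⟨m, t, ?_⟩
  rw [charMap_image_closedBall]
  intro v hv
  by_contra h
  exact hv ((ht v).1 h)

end Face

instance simplexCW : CWComplex (univ : Set (stdSimplex ℝ V)) :=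
  CWComplex.mkFinite univ (Face V) (fun _ s => s.charMap) Face.eventually_isEmpty
    (fun _ => inferInstance) (fun _ _ => rfl) (fun _ s => s.charMap_continuousOn)
    (fun _ s => s.charMap_continuousOn_symm) Face.charMap_pairwiseDisjoint Face.charMap_mapsTo
    Face.charMap_union

variable (V) in
/-- The standard simplex with vertex set `V` as a regular CW complex; its `k`-cells are the faces
with `k + 1` vertices. -/
def RegularCW.simplex : RegularCW.{u} where
  carrier := stdSimplex ℝ V
  cw := simplexCW
  fin := CWComplex.finite_mkFinite univ (Face V) (fun _ s => s.charMap) Face.eventually_isEmpty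
    (fun _ => inferInstance) (fun _ _ => rfl) (fun _ s => s.charMap_continuousOn)
    (fun _ s => s.charMap_continuousOn_symm) Face.charMap_pairwiseDisjoint Face.charMap_mapsTo
    Face.charMap_union
  injOn _ s := Face.charMap_injOn s

/-- The vertices of a cell of the simplex. -/
def simplexVerts (c : (RegularCW.simplex V).Cell) : Finset V := (c.idx : Face V c.dim).verts

lemma card_simplexVerts (c : (RegularCW.simplex V).Cell) :
    (simplexVerts c).card = c.dim + 1 := (c.idx : Face V c.dim).card_eq

lemma simplexVerts_injective : Function.Injective (simplexVerts (V := V)) := by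
  rintro ⟨k, ⟨s, hs⟩⟩ ⟨l, ⟨t, ht⟩⟩ (h : s = t)
  subst h
  have : k = l := by omega
  subst this
  rfl

lemma exists_simplexVerts {s : Finset V} (hs : s.Nonempty) :
    ∃ c : (RegularCW.simplex V).Cell, simplexVerts c = s :=
  ⟨⟨s.card - 1, (⟨s, (Nat.succ_pred_eq_of_pos hs.card_pos).symm⟩ : Face V _)⟩, rfl⟩

lemma closed_simplex (c : (RegularCW.simplex V).Cell) :
    c.closed = {x : stdSimplex ℝ V | ∀ v, v ∉ simplexVerts c → x.1 v = 0} :=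
  Face.charMap_image_closedBall (c.idx : Face V c.dim)

lemma closed_simplex_subset_iff (b c : (RegularCW.simplex V).Cell) :
    b.closed ⊆ c.closed ↔ simplexVerts b ⊆ simplexVerts c := by
  rw [closed_simplex, closed_simplex]
  constructor
  · intro h v hv
    by_contra hvc
    have := h (a := ⟨Pi.single v 1, single_mem_stdSimplex ℝ v⟩) (fun w hw => by
      have : w ≠ v := fun h => hw (h ▸ hv)
      simp [this]) v hvc
    simp at this
  · intro h x hx v hv
    exact hx v fun h' => hv (h h')

end Simplex

/-! ### Labeled cell complexes and their cellular free complexes -/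

/-- A labeled cell complex with labels in the monomials of a polynomial ring in `m` variables: a
finite regular CW complex, with an orientation given by its incidence numbers `sign G F`, and
a monomial (written as its exponent vector) on every vertex. -/
structure LabeledCellComplex (m : ℕ) extends RegularCW.{u} where
  /-- The incidence number of `G` in the boundary of `F`. -/
  sign : toRegularCW.Cell → toRegularCW.Cell → ℤ
  sign_mem : ∀ G F, sign G F = 0 ∨ sign G F = 1 ∨ sign G F = -1
  sign_ne_zero_iff : ∀ G F, sign G F ≠ 0 ↔ RegularCW.IsFacet G F
  /-- The two ends of an edge have opposite incidence numbers. -/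
  sign_edge : ∀ F : toRegularCW.Cell, F.dim = 1 → ∑ G, sign G F = 0
  /-- The boundary of a boundary vanishes. -/
  sign_sq : ∀ H F, ∑ G, sign H G * sign G F = 0
  vertexLabel : toRegularCW.CellOfDim 0 → (Fin m →₀ ℕ)

namespace LabeledCellComplex

open RegularCW CategoryTheory

variable {m : ℕ} (X Y : LabeledCellComplex.{u} m) (R : Type w) [CommRing R]

open Classical in
/-- The label (exponent vector) of a cell: the least common multiple of the labels of the vertices
it contains. -/
def label (F : X.Cell) : Fin m →₀ ℕ :=
  (Finset.univ.filter fun v : X.CellOfDim 0 => v.1.closed ⊆ F.closed).sup X.vertexLabel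

variable {X} in
lemma label_mono {G F : X.Cell} (h : G.closed ⊆ F.closed) : X.label G ≤ X.label F := by
  classical
  refine Finset.sup_mono fun v hv => ?_
  simp only [Finset.mem_filter, Finset.mem_univ, true_and] at hv ⊢
  exact hv.trans h

lemma label_vertex (v : X.CellOfDim 0) : X.label v.1 = X.vertexLabel v := by
  classical
  have : (Finset.univ.filter fun w : X.CellOfDim 0 => w.1.closed ⊆ v.1.closed) = {v} := by
    ext w
    simp only [Finset.mem_filter, Finset.mem_univ, true_and, Finset.mem_singleton]
    constructor
    · intro h
      rcases Cell.eq_or_dim_lt_of_subset h with h | h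
      · exact Subtype.ext h
      · have := v.2
        omega
    · rintro rfl
      exact subset_rfl
  rw [label, this, Finset.sup_singleton]

/-- The entry of the differential of the cellular free complex at the cells `G` (row) and `F`
(column): `sign(G,F) x^{a_F - a_G}`. -/
def coeff (G F : X.Cell) : MvPolynomial (Fin m) R :=
  MvPolynomial.monomial (X.label F - X.label G) (X.sign G F : R)

/-- The basis in homological degree `0`: one empty face for every connected component, and
a single empty face for the empty complex. -/
abbrev EmptyFace : Type u := ConnectedComponents X.carrier ⊕ PLift (IsEmpty X.carrier)

/-- The connected component of a point, as a basis element in homological degree `0`. -/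
def componentOf (x : X.carrier) : X.EmptyFace := Sum.inl (ConnectedComponents.mk x)

/-- The differential from the free module on the `(i+1)`-cells to the one on the `i`-cells. -/
def boundary (i : ℕ) : (X.CellOfDim (i + 1) →₀ MvPolynomial (Fin m) R) →ₗ[MvPolynomial (Fin m) R]
    (X.CellOfDim i →₀ MvPolynomial (Fin m) R) :=
  Finsupp.linearCombination _ fun F =>
    Finsupp.equivFunOnFinite.symm fun G : X.CellOfDim i => X.coeff R G.1 F.1

/-- The last differential: a vertex is sent to its label times its component. -/
def augmentation : (X.CellOfDim 0 →₀ MvPolynomial (Fin m) R) →ₗ[MvPolynomial (Fin m) R]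
    (X.EmptyFace →₀ MvPolynomial (Fin m) R) :=
  Finsupp.linearCombination _ fun v =>
    Finsupp.single (X.componentOf v.1.center) (MvPolynomial.monomial (X.vertexLabel v) 1)

lemma boundary_single_apply {i : ℕ} (F : X.CellOfDim (i + 1)) (G : X.CellOfDim i) :
    X.boundary R i (Finsupp.single F 1) G = X.coeff R G.1 F.1 := by
  simp [boundary]

lemma boundary_single {i : ℕ} (F : X.CellOfDim (i + 1)) :
    X.boundary R i (Finsupp.single F 1) =
      ∑ G : X.CellOfDim i, X.coeff R G.1 F.1 • Finsupp.single G 1 := by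
  classical
  refine Finsupp.ext fun G => ?_
  rw [boundary_single_apply, Finsupp.finsetSum_apply]
  simp only [Finsupp.smul_apply, Finsupp.single_apply, smul_eq_mul, mul_ite, mul_one, mul_zero,
    Finset.sum_ite_eq', Finset.mem_univ, if_true]

lemma augmentation_single (v : X.CellOfDim 0) :
    X.augmentation R (Finsupp.single v 1) =
      Finsupp.single (X.componentOf v.1.center) (MvPolynomial.monomial (X.vertexLabel v) 1) := by
  simp [augmentation]

/-- Summing a function of cells that vanishes on the cells whose dimension is not `i`. -/
lemma sum_cellOfDim {M : Type*} [AddCommMonoid M] (i : ℕ) (f : X.Cell → M)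
    (hf : ∀ c, f c ≠ 0 → c.dim = i) : ∑ c : X.CellOfDim i, f c.1 = ∑ c, f c := by
  classical
  rw [← Finset.sum_filter_of_ne (p := fun c : X.Cell => c.dim = i) fun c _ h => hf c h]
  exact Finset.sum_subtype _ (by simp) f |>.symm

lemma coeff_mul_coeff (H G F : X.Cell) :
    X.coeff R H G * X.coeff R G F =
      MvPolynomial.monomial (X.label F - X.label H) ((X.sign H G * X.sign G F : ℤ) : R) := by
  by_cases h : X.sign H G * X.sign G F = 0
  · rw [h, coeff, coeff, MvPolynomial.monomial_mul, ← Int.cast_mul, h]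
    simp
  · have h1 := X.label_mono ((X.sign_ne_zero_iff H G).1 (left_ne_zero_of_mul h)).2
    have h2 := X.label_mono ((X.sign_ne_zero_iff G F).1 (right_ne_zero_of_mul h)).2
    rw [coeff, coeff, MvPolynomial.monomial_mul, Int.cast_mul]
    rw [add_comm (X.label G - X.label H), tsub_add_tsub_cancel h2 h1]

lemma boundary_boundary (i : ℕ) : X.boundary R i ∘ₗ X.boundary R (i + 1) = 0 := by
  refine Finsupp.lhom_ext' fun F => LinearMap.ext_ring ?_
  refine Finsupp.ext fun H => ?_
  simp only [LinearMap.comp_apply, Finsupp.lsingle_apply, LinearMap.zero_comp,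
    LinearMap.zero_apply, Finsupp.coe_zero, Pi.zero_apply]
  rw [boundary_single, map_sum, Finsupp.finsetSum_apply]
  simp only [map_smul, Finsupp.smul_apply, boundary_single_apply, smul_eq_mul]
  have h2 : ∀ G : X.CellOfDim (i + 1), X.coeff R G.1 F.1 * X.coeff R H.1 G.1 =
      MvPolynomial.monomial (X.label F.1 - X.label H.1)
        ((X.sign H.1 G.1 * X.sign G.1 F.1 : ℤ) : R) := fun G => by
    rw [mul_comm, coeff_mul_coeff]
  simp only [h2]
  rw [← map_sum, ← Int.cast_sum, X.sum_cellOfDim (i + 1) (fun G => X.sign H.1 G * X.sign G F.1),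
    X.sign_sq]
  · simp
  · intro c hc
    have := ((X.sign_ne_zero_iff _ _).1 (right_ne_zero_of_mul hc)).1
    have := F.2
    omega

lemma augmentation_boundary : X.augmentation R ∘ₗ X.boundary R 0 = 0 := by
  refine Finsupp.lhom_ext' fun F => LinearMap.ext_ring ?_
  simp only [LinearMap.comp_apply, Finsupp.lsingle_apply, LinearMap.zero_comp,
    LinearMap.zero_apply]
  rw [boundary_single, map_sum]
  simp only [map_smul, augmentation_single]
  have h2 : ∀ v : X.CellOfDim 0, X.coeff R v.1 F.1 • Finsupp.single (X.componentOf v.1.center)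
      (MvPolynomial.monomial (X.vertexLabel v) (1 : R)) =
      Finsupp.single (X.componentOf F.1.center)
        (MvPolynomial.monomial (X.label F.1) (X.sign v.1 F.1 : R)) := fun v => by
    by_cases h : X.sign v.1 F.1 = 0
    · simp [coeff, h]
    · have hf := ((X.sign_ne_zero_iff _ _).1 h).2
      have hc : X.componentOf v.1.center = X.componentOf F.1.center :=
        congrArg Sum.inl (ConnectedComponents.coe_eq_coe'.2
          (F.1.isPreconnected_closed.subset_connectedComponent F.1.center_mem
            (hf v.1.center_mem)))
      rw [hc, Finsupp.smul_single, smul_eq_mul, coeff, MvPolynomial.monomial_mul, mul_one,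
        ← X.label_vertex v, tsub_add_cancel_of_le (X.label_mono hf)]
  simp only [h2]
  rw [← Finsupp.single_finsetSum, ← map_sum, ← Int.cast_sum,
    X.sum_cellOfDim 0 (fun G => X.sign G F.1), X.sign_edge _ F.2]
  · simp
  · intro c hc
    have := ((X.sign_ne_zero_iff _ _).1 hc).1
    have := F.2
    omega

/-- The modules of the cellular free complex. -/
def chainModule : ℕ → ModuleCat.{max u w} (MvPolynomial (Fin m) R)
  | 0 => ModuleCat.of _ (X.EmptyFace →₀ MvPolynomial (Fin m) R)
  | i + 1 => ModuleCat.of _ (X.CellOfDim i →₀ MvPolynomial (Fin m) R)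

/-- The differentials of the cellular free complex. -/
def chainD : ∀ i : ℕ, X.chainModule R (i + 1) ⟶ X.chainModule R i
  | 0 => ModuleCat.ofHom (X.augmentation R)
  | i + 1 => ModuleCat.ofHom (X.boundary R i)

/-- The cellular free complex `𝓕_X` of a labeled cell complex: free on the empty faces in degree
`0` and free on the cells of dimension `i` in degree `i + 1`. -/
def cellularComplex : ChainComplex (ModuleCat.{max u w} (MvPolynomial (Fin m) R)) ℕ :=
  ChainComplex.of (X.chainModule R) (X.chainD R) fun
    | 0 => by
      show ModuleCat.ofHom (X.boundary R 0) ≫ ModuleCat.ofHom (X.augmentation R) = 0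
      rw [← ModuleCat.ofHom_comp, augmentation_boundary]
      rfl
    | i + 1 => by
      show ModuleCat.ofHom (X.boundary R (i + 1)) ≫ ModuleCat.ofHom (X.boundary R i) = 0
      rw [← ModuleCat.ofHom_comp, boundary_boundary]
      rfl

/-- `𝓕_X` is a cellular resolution: it is acyclic, that is, it has nonzero homology at most in
degree `0`. -/
def IsCellularResolution : Prop := ∀ i : ℕ, (X.cellularComplex R).ExactAt (i + 1)

end LabeledCellComplex

/-! ### The product of labeled cell complexes and the simplex labeled by `1` -/

namespace LabeledCellComplex

open RegularCW CategoryTheory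

section Product

variable {m : ℕ} (X Y : LabeledCellComplex.{u} m)

open Classical in
/-- The incidence numbers of a product of cells:
`∂(σ × τ) = ∂σ × τ + (-1)^(dim σ) σ × ∂τ`. -/
def prodSign (a b : X.Cell × Y.Cell) : ℤ :=
  (if a.2 = b.2 then X.sign a.1 b.1 else 0) +
    (if a.1 = b.1 then (-1) ^ b.1.dim * Y.sign a.2 b.2 else 0)

lemma sign_self (c : X.Cell) : X.sign c c = 0 := by
  by_contra h
  have := ((X.sign_ne_zero_iff c c).1 h).1
  omega

lemma sign_dim {G F : X.Cell} (h : X.sign G F ≠ 0) : F.dim = G.dim + 1 :=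
  ((X.sign_ne_zero_iff G F).1 h).1

lemma prodSign_left {σ σ' : X.Cell} (τ : Y.Cell) :
    prodSign X Y (σ', τ) (σ, τ) = X.sign σ' σ := by
  simp [prodSign, sign_self]

lemma prodSign_right (σ : X.Cell) {τ τ' : Y.Cell} :
    prodSign X Y (σ, τ') (σ, τ) = (-1) ^ σ.dim * Y.sign τ' τ := by
  simp [prodSign, sign_self]

lemma prodSign_other {a b : X.Cell × Y.Cell} (h1 : a.1 ≠ b.1) (h2 : a.2 ≠ b.2) :
    prodSign X Y a b = 0 := by
  simp [prodSign, h1, h2]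

lemma prodSign_mem (a b : X.Cell × Y.Cell) :
    prodSign X Y a b = 0 ∨ prodSign X Y a b = 1 ∨ prodSign X Y a b = -1 := by
  obtain ⟨σ', τ'⟩ := a
  obtain ⟨σ, τ⟩ := b
  by_cases h2 : τ' = τ
  · subst h2
    rw [prodSign_left]
    exact X.sign_mem _ _
  · by_cases h1 : σ' = σ
    · subst h1
      rw [prodSign_right]
      rcases neg_one_pow_eq_or ℤ σ'.dim with h | h <;> rw [h] <;>
        rcases Y.sign_mem τ' τ with h' | h' | h' <;> rw [h'] <;> simp
    · exact Or.inl (prodSign_other X Y h1 h2)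

lemma prodSign_ne_zero_iff (a b : X.Cell × Y.Cell) :
    prodSign X Y a b ≠ 0 ↔ b.1.dim + b.2.dim = a.1.dim + a.2.dim + 1 ∧
      a.1.closed ⊆ b.1.closed ∧ a.2.closed ⊆ b.2.closed := by
  obtain ⟨σ', τ'⟩ := a
  obtain ⟨σ, τ⟩ := b
  by_cases h2 : τ' = τ
  · subst h2
    rw [prodSign_left, X.sign_ne_zero_iff, IsFacet]
    refine and_congr (by simp only; omega) ?_
    simp
  · by_cases h1 : σ' = σ
    · subst h1
      have h := Y.sign_ne_zero_iff τ' τ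
      rw [IsFacet] at h
      rw [prodSign_right, mul_ne_zero_iff, h]
      simp only [ne_eq, pow_eq_zero_iff', neg_eq_zero, one_ne_zero, false_and, not_false_eq_true,
        true_and, subset_refl]
      refine and_congr (by omega) Iff.rfl
    · rw [prodSign_other X Y h1 h2]
      refine iff_of_false (by simp) ?_
      rintro ⟨hd, hs1, hs2⟩
      have := (Cell.eq_or_dim_lt_of_subset hs1).resolve_left h1
      have := (Cell.eq_or_dim_lt_of_subset hs2).resolve_left h2
      simp only at *
      omega

lemma sum_prodSign (b : X.Cell × Y.Cell) :
    ∑ a, prodSign X Y a b =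
      ∑ σ, X.sign σ b.1 + (-1) ^ b.1.dim * ∑ τ, Y.sign τ b.2 := by
  classical
  simp only [prodSign, Finset.sum_add_distrib, Fintype.sum_prod_type]
  congr 1
  · simp
  · rw [Finset.sum_comm]
    simp [Finset.mul_sum]

lemma sum_sign_of_dim_zero (c : X.Cell) (hc : c.dim = 0) : ∑ G, X.sign G c = 0 :=
  Finset.sum_eq_zero fun G _ => by
    by_contra h
    have := X.sign_dim h
    omega

lemma prodSign_edge (b : X.Cell × Y.Cell) (hb : b.1.dim + b.2.dim = 1) :
    ∑ a, prodSign X Y a b = 0 := by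
  rw [sum_prodSign]
  rcases Nat.eq_zero_or_pos b.1.dim with h | h
  · rw [X.sum_sign_of_dim_zero _ h, Y.sign_edge _ (by omega)]
    simp
  · rw [X.sign_edge _ (by omega), Y.sum_sign_of_dim_zero _ (by omega)]
    simp

lemma prodSign_sq (a b : X.Cell × Y.Cell) :
    ∑ c, prodSign X Y a c * prodSign X Y c b = 0 := by
  classical
  obtain ⟨σ', τ'⟩ := a
  obtain ⟨σ, τ⟩ := b
  have h1 : ∑ c : X.Cell × Y.Cell, (if τ' = c.2 then X.sign σ' c.1 else 0) *
      (if c.2 = τ then X.sign c.1 σ else 0) = 0 := by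
    rw [Fintype.sum_prod_type, Finset.sum_comm]
    refine Finset.sum_eq_zero fun t _ => ?_
    by_cases ht : τ' = t
    · by_cases ht' : t = τ
      · simp only [ht, ht', if_true]
        exact X.sign_sq _ _
      · simp [ht']
    · simp [ht]
  have h2 : ∑ c : X.Cell × Y.Cell, (if τ' = c.2 then X.sign σ' c.1 else 0) *
      (if c.1 = σ then (-1) ^ σ.dim * Y.sign c.2 τ else 0) =
      X.sign σ' σ * ((-1) ^ σ.dim * Y.sign τ' τ) := by
    rw [Finset.sum_eq_single (σ, τ')]
    · simp
    · rintro ⟨s, t⟩ - hne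
      by_cases ht : τ' = t
      · have : s ≠ σ := fun h => hne (by rw [h, ht])
        simp [this]
      · simp [ht]
    · simp
  have h3 : ∑ c : X.Cell × Y.Cell, (if σ' = c.1 then (-1) ^ c.1.dim * Y.sign τ' c.2 else 0) *
      (if c.2 = τ then X.sign c.1 σ else 0) =
      ((-1) ^ σ'.dim * Y.sign τ' τ) * X.sign σ' σ := by
    rw [Finset.sum_eq_single (σ', τ)]
    · simp
    · rintro ⟨s, t⟩ - hne
      by_cases ht : σ' = s
      · have : t ≠ τ := fun h => hne (by rw [h, ht])
        simp [this]
      · simp [ht]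
    · simp
  have h4 : ∑ c : X.Cell × Y.Cell, (if σ' = c.1 then (-1) ^ c.1.dim * Y.sign τ' c.2 else 0) *
      (if c.1 = σ then (-1) ^ σ.dim * Y.sign c.2 τ else 0) = 0 := by
    rw [Fintype.sum_prod_type]
    refine Finset.sum_eq_zero fun s _ => ?_
    by_cases hs : σ' = s
    · by_cases hs' : s = σ
      · simp only [hs, hs', if_true]
        have : ∀ t, (-1 : ℤ) ^ σ.dim * Y.sign τ' t * ((-1) ^ σ.dim * Y.sign t τ) =
            (-1) ^ σ.dim * (-1) ^ σ.dim * (Y.sign τ' t * Y.sign t τ) := fun t => by ring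
        simp only [this]
        rw [← Finset.mul_sum, Y.sign_sq, mul_zero]
      · simp [hs']
    · simp [hs]
  simp only [prodSign, add_mul, mul_add, Finset.sum_add_distrib]
  rw [h1, h2, h3, h4]
  by_cases h : X.sign σ' σ = 0
  · simp [h]
  · rw [X.sign_dim h, pow_succ]
    ring

/-- The product of two labeled cell complexes: the product cell complex, where the vertex `(v, w)`
is labeled by the least common multiple of the labels of `v` and `w`. -/
def prod : LabeledCellComplex.{u} m where
  toRegularCW := X.toRegularCW.prod Y.toRegularCW
  sign a b := prodSign X Y (prodCellEquiv a) (prodCellEquiv b)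
  sign_mem a b := prodSign_mem X Y _ _
  sign_ne_zero_iff a b := by
    rw [prodSign_ne_zero_iff, IsFacet, dim_prod, dim_prod, closed_prod_subset_iff]
  sign_edge b hb := by
    rw [dim_prod] at hb
    rw [← prodSign_edge X Y (prodCellEquiv b) hb]
    exact Equiv.sum_comp prodCellEquiv fun a => prodSign X Y a (prodCellEquiv b)
  sign_sq a b := by
    rw [← prodSign_sq X Y (prodCellEquiv a) (prodCellEquiv b)]
    exact Equiv.sum_comp prodCellEquiv fun c =>
      prodSign X Y (prodCellEquiv a) c * prodSign X Y c (prodCellEquiv b)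
  vertexLabel v :=
    X.vertexLabel ⟨(prodCellEquiv v.1).1, by have := v.2; rw [dim_prod] at this; omega⟩ ⊔
      Y.vertexLabel ⟨(prodCellEquiv v.1).2, by have := v.2; rw [dim_prod] at this; omega⟩

end Product

section Simplex

variable {V : Type u} [LinearOrder V] [Fintype V]

/-- The sign `(-1)^i`, where `w` is preceded by `i` elements of `t`. -/
def removeSign (w : V) (t : Finset V) : ℤ := (-1) ^ (t.filter fun u => u < w).card

/-- The incidence numbers of the simplex: removing the vertex in position `i` has sign `(-1)^i`. -/
def faceSign (s t : Finset V) : ℤ := ∑ w ∈ t, if s = t.erase w then removeSign w t else 0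

lemma faceSign_erase {w : V} {t : Finset V} (hw : w ∈ t) :
    faceSign (t.erase w) t = removeSign w t := by
  rw [faceSign, Finset.sum_eq_single w]
  · simp
  · intro x hx hne
    rw [if_neg]
    intro h
    exact hne (Finset.erase_injOn t hw hx h).symm
  · exact fun h => absurd hw h

lemma faceSign_ne_zero_iff (s t : Finset V) :
    faceSign s t ≠ 0 ↔ ∃ w ∈ t, s = t.erase w := by
  constructor
  · intro h
    obtain ⟨w, hw, h⟩ := Finset.exists_ne_zero_of_sum_ne_zero h
    exact ⟨w, hw, by by_contra h'; exact h (if_neg h')⟩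
  · rintro ⟨w, hw, rfl⟩
    rw [faceSign_erase hw, removeSign]
    simp

lemma faceSign_mem (s t : Finset V) :
    faceSign s t = 0 ∨ faceSign s t = 1 ∨ faceSign s t = -1 := by
  by_cases h : faceSign s t = 0
  · exact Or.inl h
  · obtain ⟨w, hw, rfl⟩ := (faceSign_ne_zero_iff s t).1 h
    rw [faceSign_erase hw]
    exact Or.inr (neg_one_pow_eq_or ℤ _)

lemma exists_erase_iff (s t : Finset V) :
    (∃ w ∈ t, s = t.erase w) ↔ t.card = s.card + 1 ∧ s ⊆ t := by
  constructor
  · rintro ⟨w, hw, rfl⟩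
    exact ⟨(Finset.card_erase_add_one hw).symm, Finset.erase_subset _ _⟩
  · rintro ⟨hc, hs⟩
    have h1 : (t \ s).card = 1 := by rw [Finset.card_sdiff_of_subset hs]; omega
    obtain ⟨w, hw⟩ := Finset.card_eq_one.1 h1
    have hwt : w ∈ t \ s := by rw [hw]; simp
    refine ⟨w, (Finset.mem_sdiff.1 hwt).1, ?_⟩
    rw [Finset.erase_eq, ← hw, Finset.sdiff_sdiff_eq_self hs]

lemma removeSign_swap {w x : V} {t : Finset V} (hw : w ∈ t) (h : w < x) :
    removeSign w t * removeSign x (t.erase w) = -(removeSign x t * removeSign w (t.erase x)) := by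
  have h1 : ((t.erase w).filter fun u => u < x) = (t.filter fun u => u < x).erase w := by
    rw [Finset.filter_erase]
  have h2 : ((t.erase x).filter fun u => u < w) = t.filter fun u => u < w := by
    rw [Finset.filter_erase, Finset.erase_eq_of_notMem]
    simp [h.le]
  have h3 : (t.filter fun u => u < x).card = ((t.filter fun u => u < x).erase w).card + 1 :=
    (Finset.card_erase_add_one (by simp [hw, h])).symm
  rw [removeSign, removeSign, removeSign, removeSign, h1, h2, h3, pow_succ]
  ring

lemma faceSign_sq (r t : Finset V) :
    ∑ w ∈ t, removeSign w t * faceSign r (t.erase w) = 0 := by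
  have h : ∑ w ∈ t, removeSign w t * faceSign r (t.erase w) =
      ∑ p ∈ t.offDiag, if r = (t.erase p.1).erase p.2 then
        removeSign p.1 t * removeSign p.2 (t.erase p.1) else 0 := by
    simp only [faceSign, Finset.mul_sum, mul_ite, mul_zero]
    rw [Finset.sum_sigma']
    refine Finset.sum_bij' (fun p _ => (p.1, p.2)) (fun p _ => ⟨p.1, p.2⟩) ?_ ?_ ?_ ?_ ?_
    · rintro ⟨w, x⟩ hp
      simp only [Finset.mem_sigma, Finset.mem_erase, Finset.mem_offDiag] at hp ⊢
      exact ⟨hp.1, hp.2.2, hp.2.1.symm⟩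
    · rintro ⟨w, x⟩ hp
      simp only [Finset.mem_sigma, Finset.mem_erase, Finset.mem_offDiag] at hp ⊢
      exact ⟨hp.1, hp.2.2.symm, hp.2.1⟩
    · intros; rfl
    · intros; rfl
    · intros; rfl
  rw [h]
  refine Finset.sum_involution (fun p _ => p.swap) ?_ ?_ ?_ ?_
  · rintro ⟨w, x⟩ hp
    rw [Finset.mem_offDiag] at hp
    simp only [Prod.swap_prod_mk]
    rw [Finset.erase_right_comm (a := x) (b := w)]
    split_ifs with hr
    · rcases lt_or_gt_of_ne hp.2.2 with hlt | hlt
      · rw [removeSign_swap hp.1 hlt]; ring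
      · rw [removeSign_swap hp.2.1 hlt]; ring
    · simp
  · rintro ⟨w, x⟩ hp - heq
    rw [Finset.mem_offDiag] at hp
    exact hp.2.2 (congrArg Prod.snd heq)
  · rintro ⟨w, x⟩ hp
    rw [Finset.mem_offDiag] at hp ⊢
    exact ⟨hp.2.1, hp.1, hp.2.2.symm⟩
  · intros; rfl

lemma sum_simplex (t : Finset V) (f : Finset V → ℤ) (hf : f ∅ = 0) :
    ∑ c : (RegularCW.simplex V).Cell, f (simplexVerts c) * faceSign (simplexVerts c) t =
      ∑ w ∈ t, removeSign w t * f (t.erase w) := by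
  classical
  simp only [faceSign, Finset.mul_sum, mul_ite, mul_zero]
  rw [Finset.sum_comm]
  refine Finset.sum_congr rfl fun w hw => ?_
  by_cases hne : (t.erase w).Nonempty
  · obtain ⟨c, hc⟩ := exists_simplexVerts hne
    rw [Finset.sum_eq_single c]
    · rw [if_pos hc, hc, mul_comm]
    · intro b _ hb
      rw [if_neg]
      intro h
      exact hb (simplexVerts_injective (h.trans hc.symm))
    · simp
  · rw [Finset.not_nonempty_iff_eq_empty] at hne
    rw [hne, hf, mul_zero]
    refine Finset.sum_eq_zero fun c _ => ?_
    split_ifs with h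
    · rw [h, hf, zero_mul]
    · rfl

lemma sum_removeSign_of_card_two {t : Finset V} (ht : t.card = 2) :
    ∑ w ∈ t, removeSign w t = 0 := by
  obtain ⟨a, b, hab, rfl⟩ := Finset.card_eq_two.1 ht
  wlog h : a < b generalizing a b
  · have := this b a hab.symm (by rw [Finset.pair_comm]; exact ht)
      (lt_of_le_of_ne (not_lt.1 h) hab.symm)
    rwa [Finset.pair_comm] at this
  rw [Finset.sum_pair hab]
  have h1 : (({a, b} : Finset V).filter fun u => u < a) = ∅ := by
    ext u
    simp only [Finset.mem_filter, Finset.mem_insert, Finset.mem_singleton, Finset.notMem_empty,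
      iff_false, not_and, not_lt]
    rintro (rfl | rfl)
    · exact le_rfl
    · exact h.le
  have h2 : (({a, b} : Finset V).filter fun u => u < b) = {a} := by
    ext u
    simp only [Finset.mem_filter, Finset.mem_insert, Finset.mem_singleton]
    constructor
    · rintro ⟨rfl | rfl, h'⟩
      · rfl
      · exact absurd h' (lt_irrefl _)
    · rintro rfl
      exact ⟨Or.inl rfl, h⟩
  rw [removeSign, removeSign, h1, h2]
  simp

variable (m : ℕ) (V)

/-- The labeled cell complex of the simplex with vertex set `V`, all of whose labels are `1`. -/
def simplex : LabeledCellComplex.{u} m where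
  toRegularCW := RegularCW.simplex V
  sign G F := faceSign (simplexVerts G) (simplexVerts F)
  sign_mem G F := faceSign_mem _ _
  sign_ne_zero_iff G F := by
    rw [faceSign_ne_zero_iff, exists_erase_iff, IsFacet, closed_simplex_subset_iff,
      card_simplexVerts, card_simplexVerts]
    refine and_congr (by omega) Iff.rfl
  sign_edge F hF := by
    have h := sum_simplex (simplexVerts F) (fun s => if s = ∅ then 0 else 1) (by simp)
    have h2 : (simplexVerts F).card = 2 := by rw [card_simplexVerts, hF]
    have hne : ∀ c : (RegularCW.simplex V).Cell, simplexVerts c ≠ ∅ := fun c hc => by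
      have := card_simplexVerts c
      rw [hc] at this
      simp at this
    have hne' : ∀ w ∈ simplexVerts F, (simplexVerts F).erase w ≠ ∅ := fun w hw h => by
      have := Finset.card_erase_add_one hw
      rw [h, h2] at this
      simp at this
    simp only [hne, if_false, one_mul] at h
    rw [h, ← sum_removeSign_of_card_two h2]
    refine Finset.sum_congr rfl fun w hw => ?_
    rw [if_neg (hne' w hw), mul_one]
  sign_sq H F := by
    rw [sum_simplex (simplexVerts F) (fun s => faceSign (simplexVerts H) s) (by simp [faceSign])]
    exact faceSign_sq _ _
  vertexLabel _ := 0

variable {m}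

/-- The product construction: the product of a labeled cell complex with the simplex on the vertex
set `V` labeled by `1`. -/
abbrev prodSimplex (F : LabeledCellComplex.{u} m) : LabeledCellComplex.{u} m :=
  F.prod (simplex V m)

end Simplex

end LabeledCellComplex

/-! ### Morphisms of cellular resolutions and homotopy -/

namespace LabeledCellComplex

open RegularCW CategoryTheory

variable {m : ℕ} (R : Type w) [CommRing R]

section Morphisms

variable (X Y Z : LabeledCellComplex.{u} m)

/-- The component of a chain map in degree `0`, as a linear map between free modules. -/
def chainZero {X Y : LabeledCellComplex.{u} m} (f : X.cellularComplex R ⟶ Y.cellularComplex R) :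
    (X.EmptyFace →₀ MvPolynomial (Fin m) R) →ₗ[MvPolynomial (Fin m) R]
      (Y.EmptyFace →₀ MvPolynomial (Fin m) R) :=
  ModuleCat.Hom.hom (show X.chainModule R 0 ⟶ Y.chainModule R 0 from f.f 0)

/-- The component of a chain map in degree `i + 1`, as a linear map between the free modules on the
`i`-cells. -/
def chainSucc {X Y : LabeledCellComplex.{u} m} (f : X.cellularComplex R ⟶ Y.cellularComplex R)
    (i : ℕ) :
    (X.CellOfDim i →₀ MvPolynomial (Fin m) R) →ₗ[MvPolynomial (Fin m) R]
      (Y.CellOfDim i →₀ MvPolynomial (Fin m) R) :=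
  ModuleCat.Hom.hom (show X.chainModule R (i + 1) ⟶ Y.chainModule R (i + 1) from f.f (i + 1))

/-- A morphism of labeled cell complexes: a pair of a chain map between the cellular free complexes
and a cellular map that are compatible with each other.

* In degree `0` the chain map follows the cellular map on components, up to a monomial factor.
  (As it is a chain map, it then sends the label `x^{a_v}` of a vertex `v` to a monomial multiple of
  the label of the vertex that `v` is mapped to.)
* A generator `e_c` with `c` an `i`-cell is sent to a linear combination of the generators of those
  `i`-cells that the image of `c` covers. In particular `e_c` is sent to `0` when the image
  of `c` contains no `i`-cell. -/
@[ext]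
structure Morphism where
  chain : X.cellularComplex R ⟶ Y.cellularComplex R
  map : C(X.carrier, Y.carrier)
  cellular : ∀ n : ℕ, MapsTo map
    (RelCWComplex.skeleton (univ : Set X.carrier) (n : ℕ∞) : Set X.carrier)
    (RelCWComplex.skeleton (univ : Set Y.carrier) (n : ℕ∞) : Set Y.carrier)
  compatible_zero : ∀ a : X.EmptyFace, ∃ (t : Fin m →₀ ℕ) (b : Y.EmptyFace),
    chainZero R chain (Finsupp.single a 1) = Finsupp.single b (MvPolynomial.monomial t 1) ∧
      ∀ x, X.componentOf x = a → Y.componentOf (map x) = b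
  compatible_succ : ∀ (i : ℕ) (c : X.CellOfDim i) (d : Y.CellOfDim i),
    chainSucc R chain i (Finsupp.single c 1) d ≠ 0 → d.1.closed ⊆ map '' c.1.closed

variable {X Y Z R}

/-- The composition of `f : X → Y` and `g : Y → Z`, in diagrammatic order. -/
def Morphism.comp (f : Morphism R X Y) (g : Morphism R Y Z) : Morphism R X Z where
  chain := f.chain ≫ g.chain
  map := g.map.comp f.map
  cellular n := (g.cellular n).comp (f.cellular n)
  compatible_zero a := by
    obtain ⟨t, b, h, hx⟩ := f.compatible_zero a
    obtain ⟨t', b', h', hx'⟩ := g.compatible_zero b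
    refine ⟨t + t', b', ?_, fun x hxa => hx' _ (hx x hxa)⟩
    have : chainZero R (f.chain ≫ g.chain) (Finsupp.single a 1) =
      chainZero R g.chain (chainZero R f.chain (Finsupp.single a 1)) := rfl
    rw [this, h]
    have h1 : Finsupp.single b (MvPolynomial.monomial t (1 : R)) =
        MvPolynomial.monomial t (1 : R) • Finsupp.single b (1 : MvPolynomial (Fin m) R) := by
      rw [Finsupp.smul_single, smul_eq_mul, mul_one]
    rw [h1, map_smul, h', Finsupp.smul_single, smul_eq_mul, MvPolynomial.monomial_mul, one_mul]
  compatible_succ i c d h := by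
    classical
    have h1 : chainSucc R (f.chain ≫ g.chain) i (Finsupp.single c 1) =
      chainSucc R g.chain i (chainSucc R f.chain i (Finsupp.single c 1)) := rfl
    rw [h1, ← Finsupp.sum_single (chainSucc R f.chain i (Finsupp.single c 1)), Finsupp.sum,
      map_sum, Finsupp.finsetSum_apply] at h
    obtain ⟨e, he, hne⟩ := Finset.exists_ne_zero_of_sum_ne_zero h
    have h2 : ∀ p : MvPolynomial (Fin m) R, Finsupp.single e p = p • Finsupp.single e 1 :=
      fun p => by rw [Finsupp.smul_single, smul_eq_mul, mul_one]
    rw [h2, map_smul, Finsupp.smul_apply, smul_eq_mul] at hne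
    have h3 := f.compatible_succ i c e (Finsupp.mem_support_iff.1 he)
    have h4 := g.compatible_succ i e d (right_ne_zero_of_mul hne)
    rw [ContinuousMap.coe_comp, Set.image_comp]
    exact h4.trans (Set.image_mono h3)

/-- Two morphisms are homotopic if their chain maps are chain homotopic and their cellular maps
are homotopic as continuous maps. -/
def Morphism.Homotopic (f g : Morphism R X Y) : Prop :=
  Nonempty (Homotopy f.chain g.chain) ∧ f.map.Homotopic g.map

end Morphisms

/-- The universal property of a product up to homotopy: every pair of morphisms from a cellular
resolution `Z` to `X` and `Y` factors through `P` up to homotopy, and the factorization is unique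
up to homotopy. -/
def IsHomotopyProduct {R : Type w} [CommRing R] {P X Y : LabeledCellComplex.{u} m}
    (p : Morphism R P X) (q : Morphism R P Y) : Prop :=
  ∀ Z : LabeledCellComplex.{u} m, Z.IsCellularResolution R →
    ∀ (f : Morphism R Z X) (g : Morphism R Z Y),
      (∃ h : Morphism R Z P, (h.comp p).Homotopic f ∧ (h.comp q).Homotopic g) ∧
      ∀ h h' : Morphism R Z P,
        (h.comp p).Homotopic f → (h.comp q).Homotopic g →
        (h'.comp p).Homotopic f → (h'.comp q).Homotopic g → h.Homotopic h'

section Product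

variable (X Y : LabeledCellComplex.{u} m)

/-- The topological projection to the first factor. -/
def fstMap : C((X.prod Y).carrier, X.carrier) :=
  ⟨fun p : X.carrier × Y.carrier => p.1, continuous_fst⟩

/-- The topological projection to the second factor. -/
def sndMap : C((X.prod Y).carrier, Y.carrier) :=
  ⟨fun p : X.carrier × Y.carrier => p.2, continuous_snd⟩

variable {X Y} in
/-- The topological product map `z ↦ (f z, g z)`. -/
def pairMap {Z : Type u} [TopologicalSpace Z] (f : C(Z, X.carrier)) (g : C(Z, Y.carrier)) :
    C(Z, (X.prod Y).carrier) :=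
  ⟨fun z => ((f z, g z) : X.carrier × Y.carrier), (map_continuous f).prodMk (map_continuous g)⟩

open Classical in
/-- The entries of the block matrix of the differential of the product of `X` with a simplex
labeled by `1`, for the basis elements `(σ', τ')` (row) and `(σ, τ)` (column): a copy of the
differential of `X` for every face `τ`, and a signed copy of the boundary matrix of the simplex for
every cell `σ`. -/
def productEntry (a b : X.Cell × Y.Cell) : MvPolynomial (Fin m) R :=
  (if a.2 = b.2 then X.coeff R a.1 b.1 else 0) +
    (if a.1 = b.1 then (-1) ^ b.1.dim * (Y.sign a.2 b.2 : MvPolynomial (Fin m) R) else 0)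

end Product

end LabeledCellComplex

end

/-! The simplex is contractible, both as a space and as a chain complex, so up to homotopy the
product with it is the first factor again. Write `d` for the differential of `F` above degree `1`,
`∂` for the boundary matrix of the simplex and `ε` for the diagonal matrix of the signs `(-1)^dim`.
Since the labels of the product only see the first factor, its differential above degree `1` is `d ⊗
1 + ε ⊗ ∂` (`coeffMatrix_prodSimplex`). Let `v₀` be the least vertex and `c` the cone with apex
`v₀`. Then `∂c + c∂` is the identity minus the projection of all vertices to `v₀`
(`sign_mul_cone_add_cone_mul_sign`). As `ε` anticommutes with `d` and squares to `1`, the matrix `ε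
⊗ c` contracts the product onto the slice at `v₀`: its anticommutator with the differential is the
identity minus `ι p`, where `p` is the first projection and `ι` the inclusion at `v₀`
(`coeffMatrix_prodConeMatrix`). Hence acyclicity passes from `F` to the product
(`isCellularResolution_prodSimplex`), and the cone itself gives acyclicity of the simplex.

The rest is the comparison theorem: from a complex of free modules to an acyclic one, two chain maps
are homotopic once their difference in degree `0` factors through the last differential of the
target (`nonempty_homotopy_of_chainZero`). In the simplex that differential splits because all
labels are `1`, so any two morphisms to the simplex are homotopic (`homotopic_of_simplex`). In
degree `0` the maps `p` and `ι` are inverse bijections of bases, so they are inverse up to chain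
homotopy.

For the universal property, a morphism `φ` to `F` followed by `ι` has the required projections.
Conversely a morphism `h` with `p h ≃ φ` satisfies `h ≃ ι p h ≃ ι φ` on chains. Topologically,
homotopies into the two factors are paired into a homotopy into the product. -/

noncomputable section

/-! ### Homological algebra: the comparison theorem with prescribed degree `0` -/

open CategoryTheory in
/-- Chain maps from a complex of projectives to an exact complex are homotopic if they are so in
degree `0`. -/
theorem ChainComplex.nonempty_homotopy_of_exactAt {C : Type*} [Category C] [Abelian C]
    {P Q : ChainComplex C ℕ} (hP : ∀ i, Projective (P.X (i + 1)))
    (hQ : ∀ i, Q.ExactAt (i + 1)) (f g : P ⟶ Q) (D : P.X 0 ⟶ Q.X 1)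
    (hD : f.f 0 - g.f 0 = D ≫ Q.d 1 0) : Nonempty (Homotopy f g) := by
  -- Exactness and projectivity: a map from a projective that lands in the cycles lifts through the
  -- next differential.
  have lift : ∀ (n : ℕ) (φ : P.X (n + 1) ⟶ Q.X (n + 1)), φ ≫ Q.d (n + 1) n = 0 →
      ∃ ψ : P.X (n + 1) ⟶ Q.X (n + 2), φ = ψ ≫ Q.d (n + 2) (n + 1) := fun n φ hφ => by
    have hex := (Q.exactAt_iff' (n + 2) (n + 1) n (by simp) (by simp)).1 (hQ n)
    have := hP n
    exact ⟨hex.liftFromProjective φ hφ, (hex.liftFromProjective_comp φ hφ).symm⟩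
  -- The difference in degree `1`, corrected by `D`, lands in the cycles precisely because of `hD`.
  have h1 : ∃ ψ : P.X 1 ⟶ Q.X 2, (f - g).f 1 = P.d 1 0 ≫ D + ψ ≫ Q.d 2 1 := by
    obtain ⟨ψ, hψ⟩ := lift 0 ((f - g).f 1 - P.d 1 0 ≫ D) (by
      rw [Preadditive.sub_comp, Category.assoc, ← hD, HomologicalComplex.Hom.comm,
        HomologicalComplex.sub_f_apply, sub_self])
    exact ⟨ψ, sub_eq_iff_eq_add'.1 hψ⟩
  -- The inductive step in the shape that `Homotopy.mkInductive` asks for: two consecutive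
  -- components of the homotopy and the relation between them produce the next one.
  have hs : ∀ (n : ℕ) (p : Σ' (φ : P.X n ⟶ Q.X (n + 1)) (ψ : P.X (n + 1) ⟶ Q.X (n + 2)),
      (f - g).f (n + 1) = P.d (n + 1) n ≫ φ + ψ ≫ Q.d (n + 2) (n + 1)),
      ∃ χ : P.X (n + 2) ⟶ Q.X (n + 3),
        (f - g).f (n + 2) = P.d (n + 2) (n + 1) ≫ p.2.1 + χ ≫ Q.d (n + 3) (n + 2) := by
    rintro n ⟨φ, ψ, h⟩
    obtain ⟨χ, hχ⟩ := lift (n + 1) ((f - g).f (n + 2) - P.d (n + 2) (n + 1) ≫ ψ) (by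
      rw [Preadditive.sub_comp, Category.assoc, HomologicalComplex.Hom.comm, h,
        Preadditive.comp_add, ← Category.assoc, HomologicalComplex.d_comp_d, Limits.zero_comp,
        zero_add, sub_self])
    exact ⟨χ, sub_eq_iff_eq_add'.1 hχ⟩
  choose ψ hψ using h1
  choose χ hχ using hs
  exact ⟨Homotopy.equivSubZero.symm (Homotopy.mkInductive (f - g) D hD ψ hψ
    fun n p => ⟨χ n p, hχ n p⟩)⟩


/-! ### Acyclicity and chain maps of cellular complexes in terms of linear maps -/

namespace LabeledCellComplex

open RegularCW CategoryTheory

variable {m : ℕ} {X Y Z : LabeledCellComplex.{u} m} {R : Type w} [CommRing R]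

lemma cellularComplex_d (X : LabeledCellComplex.{u} m) (i : ℕ) :
    (X.cellularComplex R).d (i + 1) i = X.chainD R i :=
  ChainComplex.of_d _ _ _

/-- Acyclicity of the cellular free complex in terms of elements. -/
theorem isCellularResolution_iff (X : LabeledCellComplex.{u} m) :
    X.IsCellularResolution R ↔
      (∀ z, X.augmentation R z = 0 → ∃ y, X.boundary R 0 y = z) ∧
      ∀ i z, X.boundary R i z = 0 → ∃ y, X.boundary R (i + 1) y = z := by
  have key : ∀ i, (X.cellularComplex R).ExactAt (i + 1) ↔
      ∀ z : X.chainModule R (i + 1), (X.chainD R i).hom z = 0 →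
        ∃ y : X.chainModule R (i + 2), (X.chainD R (i + 1)).hom y = z := fun i => by
    rw [(X.cellularComplex R).exactAt_iff' (i + 2) (i + 1) i (by simp) (by simp),
      ShortComplex.moduleCat_exact_iff, ← cellularComplex_d, ← cellularComplex_d]
    rfl
  constructor
  · exact fun h => ⟨(key 0).1 (h 0), fun i => (key (i + 1)).1 (h (i + 1))⟩
  · rintro ⟨h0, h⟩ (_ | i)
    · exact (key 0).2 h0
    · exact (key (i + 1)).2 (h i)

instance chainModule_projective (X : LabeledCellComplex.{u} m) (i : ℕ) :
    Projective (X.chainModule R i) := by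
  cases i with
  | zero =>
    exact ModuleCat.projective_of_categoryTheory_projective
      (ModuleCat.of _ (X.EmptyFace →₀ MvPolynomial (Fin m) R))
  | succ i =>
    exact ModuleCat.projective_of_categoryTheory_projective
      (ModuleCat.of _ (X.CellOfDim i →₀ MvPolynomial (Fin m) R))

/-- Comparison: two chain maps into a resolution are homotopic if they are so in degree `0`. -/
theorem nonempty_homotopy_of_chainZero (hY : Y.IsCellularResolution R)
    (f g : X.cellularComplex R ⟶ Y.cellularComplex R)
    (D : (X.EmptyFace →₀ MvPolynomial (Fin m) R) →ₗ[MvPolynomial (Fin m) R]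
      (Y.CellOfDim 0 →₀ MvPolynomial (Fin m) R))
    (hD : chainZero R f - chainZero R g = Y.augmentation R ∘ₗ D) : Nonempty (Homotopy f g) := by
  refine ChainComplex.nonempty_homotopy_of_exactAt
    (fun i => X.chainModule_projective (i + 1)) hY f g
    (show X.chainModule R 0 ⟶ Y.chainModule R 1 from ModuleCat.ofHom D) ?_
  rw [cellularComplex_d]
  exact ModuleCat.hom_ext hD

/-- A chain map between cellular free complexes from its components. -/
def mkChain
    (f₀ : (X.EmptyFace →₀ MvPolynomial (Fin m) R) →ₗ[MvPolynomial (Fin m) R]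
      (Y.EmptyFace →₀ MvPolynomial (Fin m) R))
    (f : ∀ i, (X.CellOfDim i →₀ MvPolynomial (Fin m) R) →ₗ[MvPolynomial (Fin m) R]
      (Y.CellOfDim i →₀ MvPolynomial (Fin m) R))
    (h₀ : Y.augmentation R ∘ₗ f 0 = f₀ ∘ₗ X.augmentation R)
    (h : ∀ i, Y.boundary R i ∘ₗ f (i + 1) = f i ∘ₗ X.boundary R i) :
    X.cellularComplex R ⟶ Y.cellularComplex R :=
  ChainComplex.ofHom
    (fun
      | 0 => show X.chainModule R 0 ⟶ Y.chainModule R 0 from ModuleCat.ofHom f₀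
      | i + 1 => show X.chainModule R (i + 1) ⟶ Y.chainModule R (i + 1) from ModuleCat.ofHom (f i))
    (fun
      | 0 => by
        rw [cellularComplex_d, cellularComplex_d]
        exact ModuleCat.hom_ext h₀
      | i + 1 => by
        rw [cellularComplex_d, cellularComplex_d]
        exact ModuleCat.hom_ext (h i))

end LabeledCellComplex

/-! ### Linear maps and morphisms given by matrices indexed by all cells -/

namespace LabeledCellComplex

open RegularCW CategoryTheory

section MatrixMap

variable {m : ℕ} {X Y Z : LabeledCellComplex.{u} m} {R : Type w} [CommRing R]

/-- The linear map from the free module on the `i`-cells of `X` to the one on the `j`-cells of `Y`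
given by a block of a matrix indexed by all cells. -/
def matrixMap (A : Matrix Y.Cell X.Cell (MvPolynomial (Fin m) R)) (i j : ℕ) :
    (X.CellOfDim i →₀ MvPolynomial (Fin m) R) →ₗ[MvPolynomial (Fin m) R]
      (Y.CellOfDim j →₀ MvPolynomial (Fin m) R) :=
  Finsupp.linearCombination _ fun F =>
    Finsupp.equivFunOnFinite.symm fun G : Y.CellOfDim j => A G.1 F.1

lemma matrixMap_single_apply (A : Matrix Y.Cell X.Cell (MvPolynomial (Fin m) R)) {i j : ℕ}
    (F : X.CellOfDim i) (G : Y.CellOfDim j) :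
    matrixMap A i j (Finsupp.single F 1) G = A G.1 F.1 := by
  simp [matrixMap]

lemma matrixMap_apply (A : Matrix Y.Cell X.Cell (MvPolynomial (Fin m) R)) {i j : ℕ}
    (z : X.CellOfDim i →₀ MvPolynomial (Fin m) R) (G : Y.CellOfDim j) :
    matrixMap A i j z G = ∑ F, z F * A G.1 F.1 := by
  rw [matrixMap, Finsupp.linearCombination_apply, Finsupp.sum_fintype _ _ (by simp),
    Finsupp.finsetSum_apply]
  rfl

lemma ext_single {i : ℕ} {M : Type*} [AddCommMonoid M] [Module (MvPolynomial (Fin m) R) M]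
    {f g : (X.CellOfDim i →₀ MvPolynomial (Fin m) R) →ₗ[MvPolynomial (Fin m) R] M}
    (h : ∀ c, f (Finsupp.single c 1) = g (Finsupp.single c 1)) : f = g :=
  Finsupp.lhom_ext' fun c => LinearMap.ext_ring (h c)

/-- The matrix product sums over the cells of `Y` of every dimension; homogeneity of `B` on the
columns in question kills all but the `j`-cells. This is what allows the identities between
differentials, projections and contractions to be proved once, for ungraded matrices. -/
lemma matrixMap_comp (A : Matrix Z.Cell Y.Cell (MvPolynomial (Fin m) R))
    (B : Matrix Y.Cell X.Cell (MvPolynomial (Fin m) R)) {i j k : ℕ}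
    (hB : ∀ G F, F.dim = i → B G F ≠ 0 → G.dim = j) :
    matrixMap A j k ∘ₗ matrixMap B i j = matrixMap (A * B) i k := by
  refine ext_single fun F => Finsupp.ext fun H => ?_
  rw [LinearMap.comp_apply, matrixMap_apply, matrixMap_single_apply, Matrix.mul_apply]
  simp only [matrixMap_single_apply, mul_comm (B _ _)]
  exact Y.sum_cellOfDim j (fun G => A H.1 G * B G F.1) fun G hG =>
    hB _ _ F.2 (right_ne_zero_of_mul hG)

lemma matrixMap_add (A B : Matrix Y.Cell X.Cell (MvPolynomial (Fin m) R)) (i j : ℕ) :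
    matrixMap (A + B) i j = matrixMap A i j + matrixMap B i j := by
  refine ext_single fun F => Finsupp.ext fun G => ?_
  simp [matrixMap_single_apply]

lemma matrixMap_sub (A B : Matrix Y.Cell X.Cell (MvPolynomial (Fin m) R)) (i j : ℕ) :
    matrixMap (A - B) i j = matrixMap A i j - matrixMap B i j := by
  refine ext_single fun F => Finsupp.ext fun G => ?_
  simp [matrixMap_single_apply]

open Classical in
lemma matrixMap_one (i : ℕ) :
    matrixMap (1 : Matrix X.Cell X.Cell (MvPolynomial (Fin m) R)) i i = LinearMap.id := by
  refine ext_single fun F => Finsupp.ext fun G => ?_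
  rw [matrixMap_single_apply, Matrix.one_apply, LinearMap.id_apply, Finsupp.single_apply]
  simp only [Subtype.ext_iff, eq_comm]

variable (X R) in
/-- The matrix of the differentials of the cellular free complex in degrees at least `2`. -/
def coeffMatrix : Matrix X.Cell X.Cell (MvPolynomial (Fin m) R) :=
  Matrix.of fun G F => X.coeff R G F

lemma boundary_eq_matrixMap (i : ℕ) :
    X.boundary R i = matrixMap (X.coeffMatrix R) (i + 1) i := rfl

lemma dim_of_coeff_ne_zero {G F : X.Cell} (h : X.coeff R G F ≠ 0) : F.dim = G.dim + 1 := by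
  refine X.sign_dim fun h' => h ?_
  simp [coeff, h']

/-- The map of degree `0` modules that sends generators to generators. -/
def emptyFaceLin (e : X.EmptyFace → Y.EmptyFace) :
    (X.EmptyFace →₀ MvPolynomial (Fin m) R) →ₗ[MvPolynomial (Fin m) R]
      (Y.EmptyFace →₀ MvPolynomial (Fin m) R) :=
  Finsupp.lmapDomain _ _ e

lemma emptyFaceLin_single (e : X.EmptyFace → Y.EmptyFace) (a : X.EmptyFace)
    (x : MvPolynomial (Fin m) R) :
    emptyFaceLin e (Finsupp.single a x) = Finsupp.single (e a) x :=
  Finsupp.mapDomain_single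

lemma matrixMap_comp_boundary (A : Matrix Y.Cell X.Cell (MvPolynomial (Fin m) R)) (i : ℕ) :
    matrixMap A i i ∘ₗ X.boundary R i = matrixMap (A * X.coeffMatrix R) (i + 1) i := by
  rw [boundary_eq_matrixMap, matrixMap_comp]
  intro G F hF h
  have := dim_of_coeff_ne_zero h
  omega

/-- A morphism of labeled cell complexes from a cellular map, a map on empty faces and a matrix. -/
def Morphism.ofMatrix (f : C(X.carrier, Y.carrier))
    (hf : ∀ c : X.Cell, ∃ d : Y.Cell, d.dim ≤ c.dim ∧ MapsTo f c.closed d.closed)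
    (e : X.EmptyFace → Y.EmptyFace) (he : ∀ x, e (X.componentOf x) = Y.componentOf (f x))
    (A : Matrix Y.Cell X.Cell (MvPolynomial (Fin m) R))
    (hdim : ∀ d c, A d c ≠ 0 → d.dim = c.dim)
    (hcov : ∀ d c, A d c ≠ 0 → d.closed ⊆ f '' c.closed)
    (haug : ∀ v : X.CellOfDim 0, Y.augmentation R (matrixMap A 0 0 (Finsupp.single v 1)) =
      Finsupp.single (e (X.componentOf v.1.center)) (MvPolynomial.monomial (X.vertexLabel v) 1))
    (hA : Y.coeffMatrix R * A = A * X.coeffMatrix R) : Morphism R X Y where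
  chain := mkChain (emptyFaceLin e) (fun i => matrixMap A i i)
    (ext_single fun v => by
      rw [LinearMap.comp_apply, haug, LinearMap.comp_apply, augmentation_single,
        emptyFaceLin_single])
    (fun i => by
      rw [matrixMap_comp_boundary, ← hA, boundary_eq_matrixMap, matrixMap_comp]
      intro G F hF h
      have := hdim _ _ h
      omega)
  map := f
  cellular n := by
    intro x hx
    -- The `n`-skeleton is the union of the open cells of dimension less than `n + 1`, and `f` takes
    -- each of them into a closed cell of dimension at most `n`.
    rw [← CWComplex.iUnion_openCell_eq_skeleton] at hx
    simp only [mem_iUnion, exists_prop] at hx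
    obtain ⟨k, hk, j, hj⟩ := hx
    obtain ⟨d, hd, hfd⟩ := hf ⟨k, j⟩
    have hk' : k < n + 1 := by exact_mod_cast hk
    exact RelCWComplex.skeleton_mono (by exact_mod_cast (show d.dim ≤ n from hd.trans (by
      simp only; omega))) (RelCWComplex.closedCell_subset_skeleton d.dim d.idx
        (hfd (RelCWComplex.openCell_subset_closedCell _ _ hj)))
  compatible_zero a := by
    -- The monomial factor in degree `0` is `1` for all morphisms built this way.
    refine ⟨0, e a, emptyFaceLin_single _ _ _, ?_⟩
    rintro x rfl
    exact (he x).symm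
  compatible_succ i c d h := hcov _ _ (by
    rw [← matrixMap_single_apply A c d]
    exact h)

end MatrixMap

end LabeledCellComplex

/-! ### The cone contraction of the simplex, over the integers -/

namespace LabeledCellComplex

open RegularCW CategoryTheory

section SimplexMatrices

variable {V : Type u} [LinearOrder V] [Fintype V]

lemma simplexVerts_ne_empty (c : (RegularCW.simplex V).Cell) : simplexVerts c ≠ ∅ := fun h => by
  have := card_simplexVerts c
  rw [h] at this
  simp at this

/-- The cell of the simplex that consists of one vertex. -/
def vertexCell (v : V) : (RegularCW.simplex V).Cell :=
  (exists_simplexVerts (Finset.singleton_nonempty v)).choose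

lemma simplexVerts_vertexCell (v : V) : simplexVerts (vertexCell v) = {v} :=
  (exists_simplexVerts (Finset.singleton_nonempty v)).choose_spec

lemma dim_vertexCell (v : V) : (vertexCell v).dim = 0 := by
  have := card_simplexVerts (vertexCell v)
  rw [simplexVerts_vertexCell] at this
  simpa using this.symm

variable (V) in
/-- The boundary matrix of the simplex. -/
def signMatrix : Matrix (RegularCW.simplex V).Cell (RegularCW.simplex V).Cell ℤ :=
  Matrix.of fun G F => faceSign (simplexVerts G) (simplexVerts F)

variable (V) in
/-- The sum of the coefficients of the vertices. -/
def vertexRow : Matrix Unit (RegularCW.simplex V).Cell ℤ :=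
  Matrix.of fun _ c => if c.dim = 0 then 1 else 0

/-- The chain consisting of the vertex `v₀`. -/
def vertexCol (v₀ : V) : Matrix (RegularCW.simplex V).Cell Unit ℤ :=
  Matrix.of fun c _ => if simplexVerts c = {v₀} then 1 else 0

/-- The matrix of the cone with apex `v₀`. -/
def coneMatrix (v₀ : V) : Matrix (RegularCW.simplex V).Cell (RegularCW.simplex V).Cell ℤ :=
  Matrix.of fun r t =>
    if v₀ ∉ simplexVerts t ∧ simplexVerts r = insert v₀ (simplexVerts t) then 1 else 0

/-- The least vertex stands in position `0`, so no sign appears. -/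
lemma removeSign_of_forall_le {v₀ : V} (hv₀ : ∀ v, v₀ ≤ v) (t : Finset V) :
    removeSign v₀ t = 1 := by
  rw [removeSign, Finset.filter_false_of_mem fun u _ => (hv₀ u).not_gt]
  simp

/-- A new least vertex moves every other vertex up by one position. -/
lemma removeSign_insert {v₀ : V} (hv₀ : ∀ v, v₀ ≤ v) {t : Finset V} (h : v₀ ∉ t) {w : V}
    (hw : w ∈ t) : removeSign w (insert v₀ t) = -removeSign w t := by
  have hlt : v₀ < w := lt_of_le_of_ne (hv₀ w) fun h' => h (h' ▸ hw)
  rw [removeSign, removeSign, Finset.filter_insert, if_pos hlt,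
    Finset.card_insert_of_notMem (by simp [h]), pow_succ]
  ring

/-- A column of the cone has at most one nonzero entry, at the join of `v₀` with the face, so only
the boundary of that join is left. -/
lemma signMatrix_mul_coneMatrix_apply (v₀ : V) (r t : (RegularCW.simplex V).Cell) :
    (signMatrix V * coneMatrix v₀) r t =
      if v₀ ∈ simplexVerts t then 0
      else faceSign (simplexVerts r) (insert v₀ (simplexVerts t)) := by
  classical
  rw [Matrix.mul_apply]
  split_ifs with h
  · simp [coneMatrix, h]
  · obtain ⟨c, hc⟩ := exists_simplexVerts (Finset.insert_nonempty v₀ (simplexVerts t))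
    rw [Finset.sum_eq_single c]
    · simp [coneMatrix, signMatrix, h, hc]
    · intro b _ hb
      have : simplexVerts b ≠ insert v₀ (simplexVerts t) := fun h' =>
        hb (simplexVerts_injective (h'.trans hc.symm))
      simp [coneMatrix, this]
    · simp

/-- Faces of `t` are indexed by the vertex that is removed. The empty set is not a cell of the
simplex and has to be excluded; this missing term is the source of the defect `vertexCol v₀ *
vertexRow V`. -/
lemma coneMatrix_mul_signMatrix_apply (v₀ : V) (r t : (RegularCW.simplex V).Cell) :
    (coneMatrix v₀ * signMatrix V) r t = ∑ w ∈ simplexVerts t, removeSign w (simplexVerts t) *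
      if (simplexVerts t).erase w ≠ ∅ ∧ v₀ ∉ (simplexVerts t).erase w ∧
        simplexVerts r = insert v₀ ((simplexVerts t).erase w) then 1 else 0 := by
  rw [← sum_simplex (simplexVerts t) (fun s => if s ≠ ∅ ∧ v₀ ∉ s ∧
    simplexVerts r = insert v₀ s then 1 else 0) (by simp), Matrix.mul_apply]
  refine Finset.sum_congr rfl fun c _ => ?_
  simp only [coneMatrix, signMatrix, Matrix.of_apply, ne_eq, simplexVerts_ne_empty,
    not_false_eq_true, true_and]

lemma vertexCol_mul_vertexRow_apply (v₀ : V) (r t : (RegularCW.simplex V).Cell) :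
    (vertexCol v₀ * vertexRow V) r t =
      if simplexVerts r = {v₀} ∧ (simplexVerts t).card = 1 then 1 else 0 := by
  rw [Matrix.mul_apply, Fintype.sum_unique, card_simplexVerts]
  simp only [vertexCol, vertexRow, Matrix.of_apply, Nat.add_eq_right]
  split_ifs <;> simp_all

open Classical in
/-- The cone is a contraction of the simplex to the vertex `v₀`. -/
lemma sign_mul_cone_add_cone_mul_sign {v₀ : V} (hv₀ : ∀ v, v₀ ≤ v) :
    signMatrix V * coneMatrix v₀ + coneMatrix v₀ * signMatrix V = 1 - vertexCol v₀ * vertexRow V := by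
  ext r t
  rw [Matrix.add_apply, Matrix.sub_apply, signMatrix_mul_coneMatrix_apply,
    coneMatrix_mul_signMatrix_apply, vertexCol_mul_vertexRow_apply, Matrix.one_apply,
    ← simplexVerts_injective.eq_iff]
  have hr := simplexVerts_ne_empty r
  generalize simplexVerts r = r at hr ⊢
  -- From here on the cells only matter as nonempty sets of vertices.
  have ht := simplexVerts_ne_empty t
  generalize simplexVerts t = t at ht ⊢
  by_cases h : v₀ ∈ t
  -- If `v₀` lies in `t`, then `t` has no cone, and among its faces only the one opposite to `v₀`
  -- has a cone, namely `t`. For `t = {v₀}` that face is empty, and the right side is zero too.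
  · rw [if_pos h, Finset.sum_eq_single v₀, removeSign_of_forall_le hv₀, Finset.insert_erase h]
    · by_cases hc : t.card = 1
      · obtain ⟨x, rfl⟩ := Finset.card_eq_one.1 hc
        rw [Finset.mem_singleton] at h
        subst h
        by_cases h5 : r = {v₀} <;> simp [h5]
      · have : t.erase v₀ ≠ ∅ := fun h' => hc (by
          rw [← Finset.insert_erase h, h']; simp)
        simp [hc, this]
    · intro w _ hw
      have : v₀ ∈ t.erase w := Finset.mem_erase.2 ⟨hw.symm, h⟩
      simp [this]
    · exact fun h' => absurd h h'
  -- If `v₀` is not in `t`, removing `v₀` from the join gives `t` back, which accounts for the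
  -- identity matrix. The other faces of the join should cancel the cones over the faces of `t`.
  · rw [if_neg h, faceSign, Finset.sum_insert h, Finset.erase_insert h,
      removeSign_of_forall_le hv₀, add_assoc, ← Finset.sum_add_distrib, sub_eq_add_neg]
    refine congrArg₂ _ (by congr) ?_
    -- The cancellation takes place vertex by vertex and fails only if `t = {w}`: then the cone over
    -- the empty face is missing and the face `{v₀}` of the edge survives with sign `-1`.
    have h1 : ∀ w ∈ t, ((if r = (insert v₀ t).erase w then removeSign w (insert v₀ t) else 0) +
        removeSign w t * if t.erase w ≠ ∅ ∧ v₀ ∉ t.erase w ∧ r = insert v₀ (t.erase w)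
          then 1 else 0) = -if r = {v₀} ∧ t = {w} then 1 else 0 := by
      intro w hw
      have hne : w ≠ v₀ := fun h' => h (h' ▸ hw)
      have h2 : v₀ ∉ t.erase w := fun h' => h (Finset.mem_of_mem_erase h')
      rw [removeSign_insert hv₀ h hw, Finset.erase_insert_of_ne hne.symm]
      by_cases h3 : t.erase w = ∅
      · have h4 : t = {w} := by rw [← Finset.insert_erase hw, h3]; simp
        subst h4
        by_cases h5 : r = {v₀} <;> simp [h5, removeSign, Finset.filter_singleton]
      · have h4 : t ≠ {w} := by rintro rfl; simp at h3
        by_cases h5 : r = insert v₀ (t.erase w) <;> simp [h3, h4, h2, h5]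
    rw [Finset.sum_congr rfl h1, Finset.sum_neg_distrib]
    congr 1
    by_cases hc : t.card = 1
    · obtain ⟨x, rfl⟩ := Finset.card_eq_one.1 hc
      rw [Finset.sum_singleton]
      simp
    · have : ∀ w, t ≠ {w} := fun w h' => hc (by rw [h']; simp)
      simp [hc, this]

/-- The two ends of an edge have opposite signs. -/
lemma vertexRow_mul_signMatrix : vertexRow V * signMatrix V = 0 := by
  ext _ t
  rw [Matrix.mul_apply, Matrix.zero_apply]
  by_cases ht : t.dim = 1
  -- The incidence numbers do not depend on the polynomial ring, so `0` variables serve as well as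
  -- any other number.
  · rw [← (simplex V 0).sign_edge t ht]
    refine Finset.sum_congr rfl fun c _ => ?_
    by_cases hc : c.dim = 0
    · simp only [vertexRow, Matrix.of_apply, hc, if_true, one_mul]
      rfl
    · have : (simplex V 0).sign c t = 0 := by
        by_contra h
        have := (simplex V 0).sign_dim h
        omega
      rw [this]
      simp [vertexRow, hc]
  · refine Finset.sum_eq_zero fun c _ => ?_
    by_cases hc : c.dim = 0
    · have : (simplex V 0).sign c t = 0 := by
        by_contra h
        have := (simplex V 0).sign_dim h
        omega
      exact mul_eq_zero_of_right _ this
    · simp [vertexRow, hc]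

/-- A vertex has no facets among the cells. -/
lemma signMatrix_mul_vertexCol (v₀ : V) : signMatrix V * vertexCol v₀ = 0 := by
  ext t _
  rw [Matrix.mul_apply, Matrix.zero_apply]
  refine Finset.sum_eq_zero fun c _ => ?_
  by_cases hc : simplexVerts c = {v₀}
  · refine mul_eq_zero_of_left ?_ _
    by_contra h
    have := (simplex V 0).sign_dim (G := t) (F := c) h
    have := card_simplexVerts c
    rw [hc, Finset.card_singleton] at this
    omega
  · simp [vertexCol, hc]

end SimplexMatrices

end LabeledCellComplex

/-! ### The differential of the product as a sum of Kronecker products -/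

namespace LabeledCellComplex

open RegularCW CategoryTheory
open scoped Kronecker

variable {m : ℕ} (F : LabeledCellComplex.{u} m) (V : Type u) [LinearOrder V] [Fintype V]
  (R : Type w) [CommRing R]

lemma label_simplex (c : (simplex V m).Cell) : (simplex V m).label c = 0 := by
  refine le_antisymm ?_ zero_le
  exact Finset.sup_le fun _ _ => le_rfl

/-- The cells of the product with a simplex, as pairs of cells. -/
def pairEquiv : (F.prodSimplex V).Cell ≃ F.Cell × (RegularCW.simplex V).Cell := prodCellEquiv

lemma dim_pairEquiv (c : (F.prodSimplex V).Cell) :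
    c.dim = (F.pairEquiv V c).1.dim + (F.pairEquiv V c).2.dim := dim_prod c

lemma dim_pairEquiv_symm (a : F.Cell) (b : (RegularCW.simplex V).Cell) :
    ((F.pairEquiv V).symm (a, b)).dim = a.dim + b.dim := by
  rw [dim_pairEquiv, Equiv.apply_symm_apply]

lemma closed_pairEquiv (c : (F.prodSimplex V).Cell) :
    c.closed = (F.pairEquiv V c).1.closed ×ˢ (F.pairEquiv V c).2.closed := closed_prod c

lemma closed_subset_iff_pairEquiv (b c : (F.prodSimplex V).Cell) : b.closed ⊆ c.closed ↔
    (F.pairEquiv V b).1.closed ⊆ (F.pairEquiv V c).1.closed ∧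
      (F.pairEquiv V b).2.closed ⊆ (F.pairEquiv V c).2.closed := closed_prod_subset_iff b c

/-- A cell of the simplex contains a vertex. -/
lemma exists_vertexCell_subset (c : (RegularCW.simplex V).Cell) :
    ∃ v, (vertexCell v).closed ⊆ c.closed := by
  obtain ⟨v, hv⟩ := Finset.nonempty_iff_ne_empty.2 (simplexVerts_ne_empty c)
  exact ⟨v, (closed_simplex_subset_iff _ _).2 (by
    rw [simplexVerts_vertexCell]; simpa using hv)⟩

/-- The simplex contributes only the label `1`. All vertices of the first cell do occur, because the
second cell has a vertex with which they can be paired. -/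
lemma label_prodSimplex (c : (F.prodSimplex V).Cell) :
    (F.prodSimplex V).label c = F.label (F.pairEquiv V c).1 := by
  classical
  apply le_antisymm
  · refine Finset.sup_le fun v hv => ?_
    simp only [Finset.mem_filter, Finset.mem_univ, true_and] at hv
    have h := ((closed_subset_iff_pairEquiv F V _ _).1 hv).1
    refine sup_le ?_ zero_le
    rw [← F.label_vertex]
    exact label_mono h
  · refine Finset.sup_le fun v hv => ?_
    simp only [Finset.mem_filter, Finset.mem_univ, true_and] at hv
    obtain ⟨w, hw⟩ := exists_vertexCell_subset V (F.pairEquiv V c).2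
    have hd : ((F.pairEquiv V).symm (v.1, vertexCell w)).dim = 0 := by
      rw [dim_pairEquiv_symm, v.2, dim_vertexCell]
    have hle : (F.prodSimplex V).label ((F.pairEquiv V).symm (v.1, vertexCell w)) ≤
        (F.prodSimplex V).label c := by
      refine label_mono ((closed_subset_iff_pairEquiv F V _ _).2 ?_)
      rw [Equiv.apply_symm_apply]
      exact ⟨hv, hw⟩
    refine le_trans ?_ hle
    rw [(F.prodSimplex V).label_vertex ⟨_, hd⟩]
    exact le_sup_left

lemma coeff_simplex (a b : (simplex V m).Cell) :
    (simplex V m).coeff R a b = ((simplex V m).sign a b : MvPolynomial (Fin m) R) := by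
  rw [coeff, label_simplex, label_simplex, tsub_zero]
  simp

open Classical in
-- A step in the direction of the simplex leaves the first cell and hence the label unchanged, so
-- its exponent is zero and only the sign remains.
lemma coeff_prodSimplex (a b : (F.prodSimplex V).Cell) :
    (F.prodSimplex V).coeff R a b =
      (if (F.pairEquiv V a).2 = (F.pairEquiv V b).2 then
        F.coeff R (F.pairEquiv V a).1 (F.pairEquiv V b).1 else 0) +
      (if (F.pairEquiv V a).1 = (F.pairEquiv V b).1 then (-1) ^ (F.pairEquiv V b).1.dim *
        (signMatrix V (F.pairEquiv V a).2 (F.pairEquiv V b).2 : MvPolynomial (Fin m) R)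
        else 0) := by
  have h : (F.prodSimplex V).sign a b =
      (if (F.pairEquiv V a).2 = (F.pairEquiv V b).2 then
        F.sign (F.pairEquiv V a).1 (F.pairEquiv V b).1 else 0) +
      (if (F.pairEquiv V a).1 = (F.pairEquiv V b).1 then (-1) ^ (F.pairEquiv V b).1.dim *
        signMatrix V (F.pairEquiv V a).2 (F.pairEquiv V b).2 else 0) := rfl
  rw [coeff, label_prodSimplex, label_prodSimplex, h, Int.cast_add, map_add]
  congr 1
  · split_ifs <;> simp [coeff]
  · split_ifs with h
    · rw [h, tsub_self]
      simp
    · simp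

/-- The boundary matrix of the simplex over the polynomial ring. -/
abbrev polyMatrix (m : ℕ) (R : Type w) [CommRing R] {ι κ : Type*} (A : Matrix ι κ ℤ) :
    Matrix ι κ (MvPolynomial (Fin m) R) :=
  A.map (Int.castRingHom _)

lemma coeffMatrix_simplex :
    (simplex V m).coeffMatrix R = polyMatrix m R (signMatrix V) := by
  ext1 a b
  exact coeff_simplex V R a b

/-- The diagonal matrix of the signs `(-1) ^ dim`. -/
def dimSign : Matrix F.Cell F.Cell (MvPolynomial (Fin m) R) :=
  open Classical in Matrix.diagonal fun c => (-1) ^ c.dim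

open Classical in
-- In this form the rule for products of Kronecker products replaces all sums over pairs of cells in
-- what follows.
lemma coeffMatrix_prodSimplex : (F.prodSimplex V).coeffMatrix R =
    (F.coeffMatrix R ⊗ₖ 1 + F.dimSign R ⊗ₖ polyMatrix m R (signMatrix V)).submatrix
      (F.pairEquiv V) (F.pairEquiv V) := by
  ext1 a b
  refine (coeff_prodSimplex F V R a b).trans ?_
  rw [Matrix.submatrix_apply, Matrix.add_apply, Matrix.kroneckerMap_apply,
    Matrix.kroneckerMap_apply, Matrix.one_apply, dimSign, Matrix.diagonal_apply]
  congr 1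
  · simp only [mul_ite, mul_one, mul_zero]
    rfl
  · simp only [ite_mul, zero_mul]
    split_ifs with h
    · rw [h]
      rfl
    · rfl

open Classical in
lemma dimSign_mul_dimSign : F.dimSign R * F.dimSign R = 1 := by
  rw [dimSign, Matrix.diagonal_mul_diagonal, ← Matrix.diagonal_one]
  congr 1
  funext c
  rw [← mul_pow]
  simp

/-- The differential changes the dimension by one and so reverses the sign. This removes the mixed
terms from the contraction of the product. -/
lemma coeffMatrix_mul_dimSign :
    F.coeffMatrix R * F.dimSign R + F.dimSign R * F.coeffMatrix R = 0 := by
  classical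
  ext1 a b
  rw [Matrix.add_apply, dimSign, Matrix.mul_diagonal, Matrix.diagonal_mul, Matrix.zero_apply]
  by_cases h : F.coeffMatrix R a b = 0
  · simp [h]
  · rw [dim_of_coeff_ne_zero h, pow_succ]
    ring

end LabeledCellComplex

/-! ### Matrix identities for the projections, the inclusion and the contraction -/

namespace LabeledCellComplex

open RegularCW CategoryTheory
open scoped Kronecker

variable {m : ℕ} (F : LabeledCellComplex.{u} m) (V : Type u) [LinearOrder V] [Fintype V]
  (R : Type w) [CommRing R]

/-- The vertices of `F`, multiplied by their labels. -/
def labelRow : Matrix Unit F.Cell (MvPolynomial (Fin m) R) :=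
  Matrix.of fun _ c => if c.dim = 0 then MvPolynomial.monomial (F.label c) 1 else 0

/-- The row is supported on vertices, where the sign is `1`. -/
lemma labelRow_mul_dimSign : F.labelRow R * F.dimSign R = F.labelRow R := by
  classical
  ext1 _ c
  rw [dimSign, Matrix.mul_diagonal]
  by_cases h : c.dim = 0 <;> simp [labelRow, h]

/-- Both ends of an edge contribute the label of the edge itself, with opposite signs. -/
lemma labelRow_mul_coeffMatrix : F.labelRow R * F.coeffMatrix R = 0 := by
  ext1 _ c
  rw [Matrix.mul_apply, Matrix.zero_apply]
  by_cases hc : c.dim = 1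
  · have h : ∀ b : F.Cell, F.labelRow R () b * F.coeffMatrix R b c =
        MvPolynomial.monomial (F.label c) (F.sign b c : R) := fun b => by
      by_cases hs : F.sign b c = 0
      · simp [coeffMatrix, coeff, hs]
      · have hf := (F.sign_ne_zero_iff b c).1 hs
        have hb : b.dim = 0 := by have := hf.1; omega
        rw [labelRow, coeffMatrix, Matrix.of_apply, Matrix.of_apply, if_pos hb, coeff,
          MvPolynomial.monomial_mul, one_mul, add_tsub_cancel_of_le (label_mono hf.2)]
    rw [Finset.sum_congr rfl fun b _ => h b, ← map_sum, ← Int.cast_sum, F.sign_edge c hc]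
    simp
  · refine Finset.sum_eq_zero fun b _ => ?_
    by_cases hb : b.dim = 0
    · have : F.coeffMatrix R b c = 0 := by
        by_contra h
        have := dim_of_coeff_ne_zero h
        omega
      rw [this, mul_zero]
    · simp [labelRow, hb]

open Classical in
/-- The matrix of the projection of the product to the first factor. -/
def fstMatrix : Matrix F.Cell (F.prodSimplex V).Cell (MvPolynomial (Fin m) R) :=
  ((1 : Matrix F.Cell F.Cell _) ⊗ₖ polyMatrix m R (vertexRow V)).submatrix
    (Equiv.prodPUnit F.Cell).symm (F.pairEquiv V)

open Classical in
/-- The matrix of the projection of the product to the simplex. -/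
def sndMatrix : Matrix (RegularCW.simplex V).Cell (F.prodSimplex V).Cell (MvPolynomial (Fin m) R) :=
  (F.labelRow R ⊗ₖ (1 : Matrix (RegularCW.simplex V).Cell
    (RegularCW.simplex V).Cell _)).submatrix
    (Equiv.punitProd (RegularCW.simplex V).Cell).symm (F.pairEquiv V)

open Classical in
variable {V} in
/-- The matrix of the inclusion of `F` into the product at the vertex `v₀`. -/
def inclMatrix (v₀ : V) : Matrix (F.prodSimplex V).Cell F.Cell (MvPolynomial (Fin m) R) :=
  ((1 : Matrix F.Cell F.Cell _) ⊗ₖ polyMatrix m R (vertexCol v₀)).submatrix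
    (F.pairEquiv V) (Equiv.prodPUnit F.Cell).symm

variable {V} in
/-- The matrix of the contraction of the product to `F` along the cones with apex `v₀`. -/
def prodConeMatrix (v₀ : V) :
    Matrix (F.prodSimplex V).Cell (F.prodSimplex V).Cell (MvPolynomial (Fin m) R) :=
  (F.dimSign R ⊗ₖ polyMatrix m R (coneMatrix v₀)).submatrix (F.pairEquiv V) (F.pairEquiv V)

lemma fstMatrix_apply (d : F.Cell) (c : (F.prodSimplex V).Cell) :
    F.fstMatrix V R d c =
      open Classical in if d = (F.pairEquiv V c).1 ∧ (F.pairEquiv V c).2.dim = 0 then 1 else 0 := by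
  simp only [fstMatrix, Matrix.submatrix_apply, Matrix.kroneckerMap_apply, Matrix.one_apply,
    Matrix.map_apply, vertexRow, Matrix.of_apply, Equiv.prodPUnit_symm_apply, ite_and]
  split_ifs <;> simp

lemma sndMatrix_apply (d : (RegularCW.simplex V).Cell) (c : (F.prodSimplex V).Cell) :
    F.sndMatrix V R d c =
      open Classical in if d = (F.pairEquiv V c).2 ∧ (F.pairEquiv V c).1.dim = 0 then
        MvPolynomial.monomial (F.label (F.pairEquiv V c).1) 1 else 0 := by
  simp only [sndMatrix, Matrix.submatrix_apply, Matrix.kroneckerMap_apply, Matrix.one_apply,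
    labelRow, Matrix.of_apply, Equiv.punitProd_symm_apply, ite_and]
  split_ifs <;> simp

variable {V} in
lemma inclMatrix_apply (v₀ : V) (d : (F.prodSimplex V).Cell) (c : F.Cell) :
    F.inclMatrix R v₀ d c =
      open Classical in if d = (F.pairEquiv V).symm (c, vertexCell v₀) then 1 else 0 := by
  have h : d = (F.pairEquiv V).symm (c, vertexCell v₀) ↔
      (F.pairEquiv V d).1 = c ∧ simplexVerts (F.pairEquiv V d).2 = {v₀} := by
    rw [Equiv.eq_symm_apply, Prod.ext_iff, ← simplexVerts_vertexCell v₀,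
      simplexVerts_injective.eq_iff]
  simp only [inclMatrix, Matrix.submatrix_apply, Matrix.kroneckerMap_apply, Matrix.one_apply,
    Matrix.map_apply, vertexCol, Matrix.of_apply, Equiv.prodPUnit_symm_apply]
  split_ifs <;> simp_all

/-- The projections and the inclusion have Kronecker factors with a single row or column. A factor
of size `1 × 1` brings the differential into a shape that can be multiplied with them. -/
lemma coeffMatrix_eq_submatrix : F.coeffMatrix R =
    (F.coeffMatrix R ⊗ₖ (1 : Matrix Unit Unit _)).submatrix
      (Equiv.prodPUnit F.Cell).symm (Equiv.prodPUnit F.Cell).symm := by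
  ext1 a b
  simp [Matrix.kroneckerMap_apply]

lemma polyMatrix_eq_submatrix {ι κ : Type*} (A : Matrix ι κ ℤ) : polyMatrix m R A =
    ((1 : Matrix Unit Unit _) ⊗ₖ polyMatrix m R A).submatrix
      (Equiv.punitProd ι).symm (Equiv.punitProd κ).symm := by
  ext1 a b
  simp [Matrix.kroneckerMap_apply]

/-- The term `ε ⊗ ∂` drops out, as the row of ones on the vertices annihilates boundaries. -/
lemma coeffMatrix_mul_fstMatrix :
    F.coeffMatrix R * F.fstMatrix V R = F.fstMatrix V R * (F.prodSimplex V).coeffMatrix R := by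
  classical
  have h : polyMatrix m R (vertexRow V) * polyMatrix m R (signMatrix V) = 0 := by
    rw [← Matrix.map_mul, vertexRow_mul_signMatrix]
    simp
  rw [coeffMatrix_prodSimplex, coeffMatrix_eq_submatrix, fstMatrix, Matrix.submatrix_mul_equiv,
    Matrix.submatrix_mul_equiv, Matrix.mul_add, ← Matrix.mul_kronecker_mul,
    ← Matrix.mul_kronecker_mul, ← Matrix.mul_kronecker_mul, h,
    ← coeffMatrix_eq_submatrix]
  simp

/-- Here the term `d ⊗ 1` drops out and the sign `ε` is absorbed, both by the row of labels. -/
lemma signMatrix_mul_sndMatrix : polyMatrix m R (signMatrix V) * F.sndMatrix V R =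
    F.sndMatrix V R * (F.prodSimplex V).coeffMatrix R := by
  classical
  rw [coeffMatrix_prodSimplex, polyMatrix_eq_submatrix, sndMatrix, Matrix.submatrix_mul_equiv,
    Matrix.submatrix_mul_equiv, Matrix.mul_add, ← Matrix.mul_kronecker_mul,
    ← Matrix.mul_kronecker_mul, ← Matrix.mul_kronecker_mul, labelRow_mul_coeffMatrix,
    labelRow_mul_dimSign, ← polyMatrix_eq_submatrix]
  simp

variable {V}

/-- The term `ε ⊗ ∂` drops out, as the vertex `v₀` has zero boundary. -/
lemma coeffMatrix_mul_inclMatrix (v₀ : V) : (F.prodSimplex V).coeffMatrix R * F.inclMatrix R v₀ =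
    F.inclMatrix R v₀ * F.coeffMatrix R := by
  classical
  have h : polyMatrix m R (signMatrix V) * polyMatrix m R (vertexCol v₀) = 0 := by
    rw [← Matrix.map_mul, signMatrix_mul_vertexCol]
    simp
  rw [coeffMatrix_prodSimplex, coeffMatrix_eq_submatrix, inclMatrix, Matrix.submatrix_mul_equiv,
    Matrix.submatrix_mul_equiv, Matrix.add_mul, ← Matrix.mul_kronecker_mul,
    ← Matrix.mul_kronecker_mul, ← Matrix.mul_kronecker_mul, h,
    ← coeffMatrix_eq_submatrix]
  simp

open Classical in
lemma polyMatrix_cone {v₀ : V} (hv₀ : ∀ v, v₀ ≤ v) :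
    polyMatrix m R (signMatrix V) * polyMatrix m R (coneMatrix v₀) +
      polyMatrix m R (coneMatrix v₀) * polyMatrix m R (signMatrix V) =
    1 - polyMatrix m R (vertexCol v₀) * polyMatrix m R (vertexRow V) := by
  rw [← Matrix.map_mul, ← Matrix.map_mul, ← Matrix.map_mul, ← Matrix.map_add _ (map_add _),
    sign_mul_cone_add_cone_mul_sign hv₀, Matrix.map_sub _ (map_sub _),
    Matrix.map_one _ (map_zero _) (map_one _)]

open Classical in
/-- The inclusion at `v₀` is homotopy inverse to the projection to the first factor. -/
lemma coeffMatrix_prodConeMatrix {v₀ : V} (hv₀ : ∀ v, v₀ ≤ v) :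
    (F.prodSimplex V).coeffMatrix R * F.prodConeMatrix R v₀ +
      F.prodConeMatrix R v₀ * (F.prodSimplex V).coeffMatrix R =
    1 - F.inclMatrix R v₀ * F.fstMatrix V R := by
  have h1 : (1 : Matrix (F.prodSimplex V).Cell (F.prodSimplex V).Cell (MvPolynomial (Fin m) R)) =
      ((1 : Matrix F.Cell F.Cell _) ⊗ₖ (1 : Matrix (RegularCW.simplex V).Cell
        (RegularCW.simplex V).Cell _)).submatrix (F.pairEquiv V) (F.pairEquiv V) := by
    rw [Matrix.one_kronecker_one, Matrix.submatrix_one_equiv]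
  have h2 : ∀ A B : Matrix (F.Cell × (RegularCW.simplex V).Cell)
      (F.Cell × (RegularCW.simplex V).Cell) (MvPolynomial (Fin m) R),
      A.submatrix (F.pairEquiv V) (F.pairEquiv V) + B.submatrix (F.pairEquiv V) (F.pairEquiv V) =
        (A + B).submatrix (F.pairEquiv V) (F.pairEquiv V) := fun _ _ => rfl
  have h3 : ∀ A B : Matrix (F.Cell × (RegularCW.simplex V).Cell)
      (F.Cell × (RegularCW.simplex V).Cell) (MvPolynomial (Fin m) R),
      A.submatrix (F.pairEquiv V) (F.pairEquiv V) - B.submatrix (F.pairEquiv V) (F.pairEquiv V) =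
        (A - B).submatrix (F.pairEquiv V) (F.pairEquiv V) := fun _ _ => rfl
  rw [h1, coeffMatrix_prodSimplex, prodConeMatrix, inclMatrix, fstMatrix,
    Matrix.submatrix_mul_equiv, Matrix.submatrix_mul_equiv, Matrix.submatrix_mul_equiv, h2, h3,
    Matrix.add_mul, Matrix.mul_add, ← Matrix.mul_kronecker_mul, ← Matrix.mul_kronecker_mul,
    ← Matrix.mul_kronecker_mul, ← Matrix.mul_kronecker_mul, ← Matrix.mul_kronecker_mul,
    dimSign_mul_dimSign, Matrix.one_mul, Matrix.one_mul, Matrix.mul_one]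
  congr 1
  -- The sum is regrouped as `(dε + εd) ⊗ c + ε² ⊗ (∂c + c∂)`; the first term vanishes and the
  -- second is given by the cone identity.
  rw [add_add_add_comm, ← Matrix.add_kronecker, coeffMatrix_mul_dimSign, Matrix.zero_kronecker,
    zero_add, ← Matrix.kronecker_add, polyMatrix_cone R hv₀]
  ext1 a b
  simp [Matrix.kroneckerMap_apply, mul_sub]
  exact congrFun₂ Matrix.one_kronecker_one a b

end LabeledCellComplex

/-! ### Connected components and labels of vertices of the product -/

namespace LabeledCellComplex

open RegularCW CategoryTheory

variable {m : ℕ} (F : LabeledCellComplex.{u} m) (V : Type u) [LinearOrder V] [Fintype V]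
  (R : Type w) [CommRing R]

variable {F} in
lemma componentOf_eq_of_mem {c : F.Cell} {x : F.carrier} (hx : x ∈ c.closed) :
    F.componentOf x = F.componentOf c.center :=
  congrArg Sum.inl (ConnectedComponents.coe_eq_coe'.2
    (c.isPreconnected_closed.subset_connectedComponent c.center_mem hx))

lemma mem_closed_iff_pairEquiv (c : (F.prodSimplex V).Cell) (x : (F.prodSimplex V).carrier) :
    x ∈ c.closed ↔ fstMap F (simplex V m) x ∈ (F.pairEquiv V c).1.closed ∧
      sndMap F (simplex V m) x ∈ (F.pairEquiv V c).2.closed := by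
  rw [closed_pairEquiv]
  exact Iff.rfl

lemma augmentation_single' (v : F.CellOfDim 0) (x : MvPolynomial (Fin m) R) :
    F.augmentation R (Finsupp.single v x) = Finsupp.single (F.componentOf v.1.center)
      (x * MvPolynomial.monomial (F.vertexLabel v) 1) := by
  rw [← mul_one x, ← smul_eq_mul, ← Finsupp.smul_single, map_smul, augmentation_single,
    Finsupp.smul_single, smul_eq_mul, smul_eq_mul, mul_one]

variable {F R} in
lemma matrixMap_single_eq_single {X : LabeledCellComplex.{u} m}
    {A : Matrix X.Cell F.Cell (MvPolynomial (Fin m) R)} {i j : ℕ} {c : F.CellOfDim i}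
    {d : X.CellOfDim j} {x : MvPolynomial (Fin m) R} (h : A d.1 c.1 = x)
    (h' : ∀ d', d' ≠ d.1 → A d' c.1 = 0) :
    matrixMap A i j (Finsupp.single c 1) = Finsupp.single d x := by
  refine Finsupp.ext fun d' => ?_
  rw [matrixMap_single_apply]
  by_cases hd : d' = d
  · rw [hd, h, Finsupp.single_eq_same]
  · rw [h' d'.1 fun h => hd (Subtype.ext h), Finsupp.single_eq_of_ne hd]

/-! ### The projections and the inclusion at a vertex -/

variable {F} in
/-- The map of empty faces induced by a continuous map. -/
def emptyFaceMap {X : LabeledCellComplex.{u} m} (f : C(F.carrier, X.carrier))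
    (hf : IsEmpty F.carrier → IsEmpty X.carrier) : F.EmptyFace → X.EmptyFace :=
  Sum.map (map_continuous f).connectedComponentsMap fun h => ⟨hf h.down⟩

lemma dim_of_dim_eq_zero (v : (F.prodSimplex V).CellOfDim 0) :
    (F.pairEquiv V v.1).1.dim = 0 ∧ (F.pairEquiv V v.1).2.dim = 0 := by
  have := v.2
  rw [dim_pairEquiv] at this
  omega

lemma vertexLabel_prodSimplex (v : (F.prodSimplex V).CellOfDim 0) :
    (F.prodSimplex V).vertexLabel v =
      F.vertexLabel ⟨(F.pairEquiv V v.1).1, (F.dim_of_dim_eq_zero V v).1⟩ := by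
  rw [← label_vertex, label_prodSimplex, ← F.label_vertex]

variable {V}

/-- A vertex of the simplex as a point. -/
def vertexPoint (m : ℕ) (v₀ : V) : (simplex V m).carrier :=
  (⟨Pi.single v₀ 1, single_mem_stdSimplex ℝ v₀⟩ : stdSimplex ℝ V)

lemma mem_closed_vertexCell_iff (v₀ : V) (x : (simplex V m).carrier) :
    x ∈ (vertexCell v₀).closed ↔ x = vertexPoint m v₀ := by
  rw [closed_simplex, simplexVerts_vertexCell]
  constructor
  · intro (hx : ∀ v, v ∉ ({v₀} : Finset V) → (x : stdSimplex ℝ V).1 v = 0)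
    refine Subtype.ext (funext fun v => ?_)
    have h1 := (x : stdSimplex ℝ V).2.2
    rw [Finset.sum_eq_single v₀ (fun w _ hw => hx w (by simpa using hw)) (by simp)] at h1
    by_cases hv : v = v₀
    · subst hv
      simpa [vertexPoint] using h1
    · rw [hx v (by simpa using hv)]
      simp [vertexPoint, hv]
  · rintro rfl v hv
    have : v ≠ v₀ := by simpa using hv
    simp [vertexPoint, this]

/-- The inclusion of `F` into the product with the simplex at the vertex `v₀`. -/
def inclMap (v₀ : V) : C(F.carrier, (F.prodSimplex V).carrier) :=
  pairMap (X := F) (Y := simplex V m) (ContinuousMap.id _)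
    (ContinuousMap.const _ (vertexPoint m v₀))

lemma isEmpty_carrier_of_prodSimplex (v₀ : V) (h : IsEmpty (F.prodSimplex V).carrier) :
    IsEmpty F.carrier :=
  ⟨fun x => h.false (F.inclMap v₀ x)⟩

lemma isEmpty_prodSimplex (h : IsEmpty F.carrier) : IsEmpty (F.prodSimplex V).carrier :=
  ⟨fun x => h.false (fstMap F (simplex V m) x)⟩

lemma contractibleSpace_simplex (v₀ : V) : ContractibleSpace (simplex V m).carrier :=
  (convex_stdSimplex ℝ V).contractibleSpace ⟨_, single_mem_stdSimplex ℝ v₀⟩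

/-- The simplex is nonempty and connected, so its complex has rank one in degree `0`. -/
lemma emptyFace_simplex_eq (v₀ : V) (a b : (simplex V m).EmptyFace) : a = b := by
  have := contractibleSpace_simplex (m := m) v₀
  rcases a with a | ⟨⟨a⟩⟩
  · rcases b with b | ⟨⟨b⟩⟩
    · exact congrArg Sum.inl (Subsingleton.elim a b)
    · exact (b.false (vertexPoint m v₀)).elim
  · exact (a.false (vertexPoint m v₀)).elim

/-- The empty faces of the product correspond to those of `F`. -/
def emptyFaceEquiv (v₀ : V) : (F.prodSimplex V).EmptyFace ≃ F.EmptyFace where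
  toFun := emptyFaceMap (fstMap F (simplex V m)) (F.isEmpty_carrier_of_prodSimplex v₀)
  invFun := emptyFaceMap (F.inclMap v₀) F.isEmpty_prodSimplex
  left_inv a := by
    rcases a with a | a
    · obtain ⟨⟨x, y⟩, rfl⟩ := ConnectedComponents.surjective_coe a
      refine congrArg Sum.inl (ConnectedComponents.coe_eq_coe'.2 ?_)
      have := contractibleSpace_simplex (m := m) v₀
      -- The points `(x, y)` and `(x, v₀)` lie in one component because the slice over `x` is
      -- connected.
      have h : IsPreconnected (({x} : Set F.carrier) ×ˢ (univ : Set (simplex V m).carrier)) :=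
        isPreconnected_singleton.prod isPreconnected_univ
      exact h.subset_connectedComponent (x := (x, y)) ⟨rfl, trivial⟩ ⟨rfl, trivial⟩
    · rfl
  right_inv a := by
    rcases a with a | a
    · obtain ⟨x, rfl⟩ := ConnectedComponents.surjective_coe a
      rfl
    · rfl

lemma eq_of_fstMatrix_ne_zero {d : F.Cell} {c : (F.prodSimplex V).Cell}
    (h : F.fstMatrix V R d c ≠ 0) : d = (F.pairEquiv V c).1 ∧ (F.pairEquiv V c).2.dim = 0 := by
  rw [fstMatrix_apply] at h
  exact of_not_not fun h' => h (if_neg h')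

lemma eq_of_sndMatrix_ne_zero {d : (RegularCW.simplex V).Cell} {c : (F.prodSimplex V).Cell}
    (h : F.sndMatrix V R d c ≠ 0) : d = (F.pairEquiv V c).2 ∧ (F.pairEquiv V c).1.dim = 0 := by
  rw [sndMatrix_apply] at h
  exact of_not_not fun h' => h (if_neg h')

lemma eq_of_inclMatrix_ne_zero {v₀ : V} {d : (F.prodSimplex V).Cell} {c : F.Cell}
    (h : F.inclMatrix R v₀ d c ≠ 0) : d = (F.pairEquiv V).symm (c, vertexCell v₀) := by
  rw [inclMatrix_apply] at h
  exact of_not_not fun h' => h (if_neg h')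

/-- The projection of the product to the first factor. -/
def fstMorphism (v₀ : V) : Morphism R (F.prodSimplex V) F :=
  Morphism.ofMatrix (fstMap F (simplex V m))
    (fun c => ⟨(F.pairEquiv V c).1, by rw [dim_pairEquiv]; omega,
      fun x hx => ((F.mem_closed_iff_pairEquiv V c x).1 hx).1⟩)
    -- The forward map is induced by the projection and does not depend on `v₀`, which only
    -- witnesses that the simplex is nonempty.
    (F.emptyFaceEquiv v₀) (fun _ => rfl) (F.fstMatrix V R)
    (fun d c h => by
      obtain ⟨rfl, h'⟩ := eq_of_fstMatrix_ne_zero F R h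
      rw [dim_pairEquiv, h', add_zero])
    (fun d c h => by
      obtain ⟨rfl, h'⟩ := eq_of_fstMatrix_ne_zero F R h
      intro x hx
      exact ⟨(x, (F.pairEquiv V c).2.center),
        (F.mem_closed_iff_pairEquiv V c _).2 ⟨hx, Cell.center_mem _⟩, rfl⟩)
    (fun v => by
      obtain ⟨h1, h2⟩ := F.dim_of_dim_eq_zero V v
      rw [matrixMap_single_eq_single (d := ⟨(F.pairEquiv V v.1).1, h1⟩) (x := 1),
        augmentation_single, vertexLabel_prodSimplex]
      · exact congrArg (fun a => Finsupp.single a _) (componentOf_eq_of_mem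
          ((F.mem_closed_iff_pairEquiv V v.1 _).1 (Cell.center_mem _)).1).symm
      · rw [fstMatrix_apply, if_pos ⟨rfl, h2⟩]
      · intro d hd
        rw [fstMatrix_apply, if_neg fun h => hd h.1])
    (F.coeffMatrix_mul_fstMatrix V R)

/-- The projection of the product to the simplex. -/
def sndMorphism (v₀ : V) : Morphism R (F.prodSimplex V) (simplex V m) :=
  Morphism.ofMatrix (sndMap F (simplex V m))
    (fun c => ⟨(F.pairEquiv V c).2, by rw [dim_pairEquiv]; omega,
      fun x hx => ((F.mem_closed_iff_pairEquiv V c x).1 hx).2⟩)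
    (fun _ => (simplex V m).componentOf (vertexPoint m v₀))
    (fun _ => emptyFace_simplex_eq v₀ _ _) (F.sndMatrix V R)
    (fun d c h => by
      obtain ⟨rfl, h'⟩ := eq_of_sndMatrix_ne_zero F R h
      rw [dim_pairEquiv, h', zero_add])
    (fun d c h => by
      obtain ⟨rfl, h'⟩ := eq_of_sndMatrix_ne_zero F R h
      intro x hx
      exact ⟨((F.pairEquiv V c).1.center, x),
        (F.mem_closed_iff_pairEquiv V c _).2 ⟨Cell.center_mem _, hx⟩, rfl⟩)
    (fun v => by
      obtain ⟨h1, h2⟩ := F.dim_of_dim_eq_zero V v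
      -- A vertex `(v, w)` goes to the label of `v` times `w`: vertices of the simplex have label
      -- `1`, so this factor is forced by compatibility with the augmentations.
      refine (congrArg _ (matrixMap_single_eq_single (X := simplex V m)
        (A := F.sndMatrix V R) (d := ⟨(F.pairEquiv V v.1).2, h2⟩)
        (x := MvPolynomial.monomial (F.label (F.pairEquiv V v.1).1) 1) ?_ ?_)).trans ?_
      · exact (F.sndMatrix_apply V R _ _).trans (if_pos ⟨rfl, h1⟩)
      · exact fun d hd => (F.sndMatrix_apply V R _ _).trans (if_neg fun h => hd h.1)
      · rw [augmentation_single', ← label_vertex, ← label_vertex, label_simplex,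
          label_prodSimplex, MvPolynomial.monomial_mul, add_zero, one_mul]
        congr 1
        exact emptyFace_simplex_eq v₀ _ _)
    (by
      rw [coeffMatrix_simplex]
      exact F.signMatrix_mul_sndMatrix V R)

/-- The inclusion of `F` into the product at the vertex `v₀`. -/
def inclMorphism (v₀ : V) : Morphism R F (F.prodSimplex V) :=
  Morphism.ofMatrix (F.inclMap v₀)
    (fun c => ⟨(F.pairEquiv V).symm (c, vertexCell v₀), by
        rw [dim_pairEquiv_symm, dim_vertexCell, add_zero],
      fun x hx => by
        rw [mem_closed_iff_pairEquiv, Equiv.apply_symm_apply]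
        exact ⟨hx, (mem_closed_vertexCell_iff v₀ _).2 rfl⟩⟩)
    (F.emptyFaceEquiv v₀).symm (fun _ => rfl) (F.inclMatrix R v₀)
    (fun d c h => by
      obtain rfl := eq_of_inclMatrix_ne_zero F R h
      rw [dim_pairEquiv_symm, dim_vertexCell, add_zero])
    (fun d c h => by
      obtain rfl := eq_of_inclMatrix_ne_zero F R h
      intro x hx
      rw [mem_closed_iff_pairEquiv, Equiv.apply_symm_apply] at hx
      exact ⟨_, hx.1, Prod.ext rfl ((mem_closed_vertexCell_iff v₀ _).1 hx.2).symm⟩)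
    (fun v => by
      have hd : ((F.pairEquiv V).symm (v.1, vertexCell v₀)).dim = 0 := by
        rw [dim_pairEquiv_symm, dim_vertexCell, add_zero, v.2]
      rw [matrixMap_single_eq_single (d := ⟨(F.pairEquiv V).symm (v.1, vertexCell v₀), hd⟩)
        (x := 1), augmentation_single]
      · congr 1
        · refine (componentOf_eq_of_mem (x := F.inclMap v₀ v.1.center) ?_).symm
          rw [mem_closed_iff_pairEquiv, Equiv.apply_symm_apply]
          exact ⟨Cell.center_mem _, (mem_closed_vertexCell_iff v₀ _).2 rfl⟩
        · rw [← label_vertex, label_prodSimplex, Equiv.apply_symm_apply, label_vertex]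
      · rw [inclMatrix_apply, if_pos rfl]
      · intro d hd
        rw [inclMatrix_apply, if_neg hd])
    (F.coeffMatrix_mul_inclMatrix R v₀)

end LabeledCellComplex

namespace LabeledCellComplex

open RegularCW CategoryTheory
open scoped Kronecker

variable {m : ℕ} (F : LabeledCellComplex.{u} m) {V : Type u} [LinearOrder V] [Fintype V]
  (R : Type w) [CommRing R]

/-! ### Acyclicity of the simplex and of the product -/

lemma dim_of_coneMatrix_ne_zero {v₀ : V} {r t : (RegularCW.simplex V).Cell}
    (h : coneMatrix v₀ r t ≠ 0) : r.dim = t.dim + 1 := by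
  obtain ⟨h1, h2⟩ := of_not_not fun h' => h (if_neg h')
  have h3 := card_simplexVerts r
  rw [h2, Finset.card_insert_of_notMem h1, card_simplexVerts] at h3
  omega

lemma dim_of_prodConeMatrix_ne_zero {v₀ : V} {r t : (F.prodSimplex V).Cell}
    (h : F.prodConeMatrix R v₀ r t ≠ 0) : r.dim = t.dim + 1 := by
  classical
  rw [prodConeMatrix, Matrix.submatrix_apply, Matrix.kroneckerMap_apply, dimSign,
    Matrix.diagonal_apply] at h
  have h1 : (F.pairEquiv V r).1 = (F.pairEquiv V t).1 :=
    of_not_not fun h' => left_ne_zero_of_mul h (if_neg h')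
  have h2 := dim_of_coneMatrix_ne_zero fun h' => right_ne_zero_of_mul h
    ((congrArg (Int.castRingHom _) h').trans (map_zero _))
  rw [dim_pairEquiv, dim_pairEquiv, h1, h2, add_assoc]

variable {F R} in
-- The augmentation is not part of `coeffMatrix`, whose columns at vertices are zero. In dimension
-- `0` only the half `∂K` of a contraction is therefore present.
lemma matrixMap_mul_coeffMatrix_zero {X : LabeledCellComplex.{u} m}
    (A : Matrix X.Cell F.Cell (MvPolynomial (Fin m) R)) (j : ℕ) :
    matrixMap (A * F.coeffMatrix R) 0 j = 0 := by
  refine ext_single fun c => Finsupp.ext fun d => ?_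
  rw [matrixMap_single_apply, Matrix.mul_apply]
  refine Finset.sum_eq_zero fun b _ => ?_
  have : F.coeffMatrix R b c.1 = 0 := by
    by_contra h
    have := dim_of_coeff_ne_zero h
    have := c.2
    omega
  rw [this, mul_zero]

variable {F R} in
/-- A contraction given by a matrix, on chains in positive dimension. -/
lemma boundary_contraction_succ {K H : Matrix F.Cell F.Cell (MvPolynomial (Fin m) R)}
    (hK : ∀ r t, K r t ≠ 0 → r.dim = t.dim + 1)
    (h : F.coeffMatrix R * K + K * F.coeffMatrix R = H) (i : ℕ)
    {z : F.CellOfDim (i + 1) →₀ MvPolynomial (Fin m) R} (hz : F.boundary R i z = 0) :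
    F.boundary R (i + 1) (matrixMap K (i + 1) (i + 2) z) = matrixMap H (i + 1) (i + 1) z := by
  have h1 : F.boundary R (i + 1) ∘ₗ matrixMap K (i + 1) (i + 2) =
      matrixMap (F.coeffMatrix R * K) (i + 1) (i + 1) := by
    rw [boundary_eq_matrixMap, matrixMap_comp]
    intro r t ht hr
    rw [hK r t hr, ht]
  have h2 : matrixMap K i (i + 1) ∘ₗ F.boundary R i =
      matrixMap (K * F.coeffMatrix R) (i + 1) (i + 1) := by
    rw [boundary_eq_matrixMap, matrixMap_comp]
    intro r t ht hr
    have := dim_of_coeff_ne_zero hr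
    omega
  rw [← h, matrixMap_add, ← h1, ← h2, LinearMap.add_apply, LinearMap.comp_apply,
    LinearMap.comp_apply, hz, map_zero, add_zero]

variable {F R} in
/-- A contraction given by a matrix, on chains in dimension `0`. -/
lemma boundary_contraction_zero {K H : Matrix F.Cell F.Cell (MvPolynomial (Fin m) R)}
    (hK : ∀ r t, K r t ≠ 0 → r.dim = t.dim + 1)
    (h : F.coeffMatrix R * K + K * F.coeffMatrix R = H)
    (z : F.CellOfDim 0 →₀ MvPolynomial (Fin m) R) :
    F.boundary R 0 (matrixMap K 0 1 z) = matrixMap H 0 0 z := by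
  have h1 : F.boundary R 0 ∘ₗ matrixMap K 0 1 = matrixMap (F.coeffMatrix R * K) 0 0 := by
    rw [boundary_eq_matrixMap, matrixMap_comp]
    intro r t ht hr
    rw [hK r t hr, ht]
  rw [← h, matrixMap_add, ← h1, matrixMap_mul_coeffMatrix_zero, add_zero, LinearMap.comp_apply]

/-- This is the lowest commuting square of the chain map underlying `fstMorphism`. -/
lemma augmentation_comp_fstMatrix (v₀ : V) :
    F.augmentation R ∘ₗ matrixMap (F.fstMatrix V R) 0 0 =
      emptyFaceLin (F.emptyFaceEquiv v₀) ∘ₗ (F.prodSimplex V).augmentation R := by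
  have h := (F.fstMorphism R v₀).chain.comm 1 0
  rw [cellularComplex_d, cellularComplex_d] at h
  exact congrArg ModuleCat.Hom.hom h

lemma boundary_comp_fstMatrix (i : ℕ) :
    F.boundary R i ∘ₗ matrixMap (F.fstMatrix V R) (i + 1) (i + 1) =
      matrixMap (F.fstMatrix V R) i i ∘ₗ (F.prodSimplex V).boundary R i := by
  rw [matrixMap_comp_boundary, ← coeffMatrix_mul_fstMatrix, boundary_eq_matrixMap, matrixMap_comp]
  intro r t ht hr
  obtain ⟨rfl, h⟩ := eq_of_fstMatrix_ne_zero F R hr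
  rw [← ht, dim_pairEquiv, h, add_zero]

lemma boundary_comp_inclMatrix (v₀ : V) (i : ℕ) :
    (F.prodSimplex V).boundary R i ∘ₗ matrixMap (F.inclMatrix R v₀) (i + 1) (i + 1) =
      matrixMap (F.inclMatrix R v₀) i i ∘ₗ F.boundary R i := by
  rw [matrixMap_comp_boundary, ← coeffMatrix_mul_inclMatrix, boundary_eq_matrixMap, matrixMap_comp]
  intro r t ht hr
  obtain rfl := eq_of_inclMatrix_ne_zero F R hr
  rw [← ht, dim_pairEquiv_symm, dim_vertexCell, add_zero]

lemma matrixMap_inclMatrix_mul_fstMatrix (v₀ : V) (i : ℕ) :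
    matrixMap (F.inclMatrix R v₀ * F.fstMatrix V R) i i =
      matrixMap (F.inclMatrix R v₀) i i ∘ₗ matrixMap (F.fstMatrix V R) i i := by
  rw [matrixMap_comp]
  intro r t ht hr
  obtain ⟨rfl, h⟩ := eq_of_fstMatrix_ne_zero F R hr
  rw [← ht, dim_pairEquiv, h, add_zero]

variable {F R} in
/-- The product of a cellular resolution with a simplex is a cellular resolution. -/
theorem isCellularResolution_prodSimplex {v₀ : V} (hv₀ : ∀ v, v₀ ≤ v)
    (hF : F.IsCellularResolution R) : (F.prodSimplex V).IsCellularResolution R := by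
  classical
  obtain ⟨hF0, hF⟩ := (isCellularResolution_iff F).1 hF
  have hK : ∀ r t, F.prodConeMatrix R v₀ r t ≠ 0 → r.dim = t.dim + 1 :=
    fun r t => F.dim_of_prodConeMatrix_ne_zero R
  have hH := F.coeffMatrix_prodConeMatrix R hv₀
  refine (isCellularResolution_iff _).2 ⟨fun z hz => ?_, fun i z hz => ?_⟩
  · have h1 := boundary_contraction_zero hK hH z
    rw [matrixMap_sub, matrixMap_one, matrixMap_inclMatrix_mul_fstMatrix] at h1
    -- The projection of the cycle `z` bounds some `y` in `F`. The contraction bounds `z - ι p z`,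
    -- and `ι y` bounds `ι p z`, so their sum bounds `z`.
    obtain ⟨y, hy⟩ := hF0 (matrixMap (F.fstMatrix V R) 0 0 z) (by
      rw [← LinearMap.comp_apply, augmentation_comp_fstMatrix F R v₀, LinearMap.comp_apply, hz,
        map_zero])
    refine ⟨matrixMap (F.prodConeMatrix R v₀) 0 1 z + matrixMap (F.inclMatrix R v₀) 1 1 y, ?_⟩
    have h2 := LinearMap.congr_fun (F.boundary_comp_inclMatrix R v₀ 0) y
    rw [LinearMap.comp_apply, LinearMap.comp_apply, hy] at h2
    rw [map_add, h1, h2]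
    simp
  · have h1 := boundary_contraction_succ hK hH i hz
    rw [matrixMap_sub, matrixMap_one, matrixMap_inclMatrix_mul_fstMatrix] at h1
    obtain ⟨y, hy⟩ := hF i (matrixMap (F.fstMatrix V R) (i + 1) (i + 1) z) (by
      rw [← LinearMap.comp_apply, boundary_comp_fstMatrix, LinearMap.comp_apply, hz, map_zero])
    refine ⟨matrixMap (F.prodConeMatrix R v₀) (i + 1) (i + 2) z +
      matrixMap (F.inclMatrix R v₀) (i + 2) (i + 2) y, ?_⟩
    have h2 := LinearMap.congr_fun (F.boundary_comp_inclMatrix R v₀ (i + 1)) y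
    rw [LinearMap.comp_apply, LinearMap.comp_apply, hy] at h2
    rw [map_add, h1, h2]
    simp

lemma vertexCol_mul_vertexRow_eq {v₀ : V} (r t : (RegularCW.simplex V).Cell) :
    (vertexCol v₀ * vertexRow V) r t =
      if simplexVerts r = {v₀} ∧ t.dim = 0 then 1 else 0 := by
  rw [vertexCol_mul_vertexRow_apply, card_simplexVerts]
  simp

/-- The simplex is a cellular resolution. -/
theorem isCellularResolution_simplex {v₀ : V} (hv₀ : ∀ v, v₀ ≤ v) :
    (simplex V m).IsCellularResolution R := by
  classical
  -- `K` is the cone and `H` the projection of all vertices to `v₀`; these three properties are all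
  -- that the argument needs.
  obtain ⟨K, H, hK, hH, hE⟩ : ∃ K H : Matrix (simplex V m).Cell (simplex V m).Cell
      (MvPolynomial (Fin m) R), (∀ r t, K r t ≠ 0 → r.dim = t.dim + 1) ∧
      (simplex V m).coeffMatrix R * K + K * (simplex V m).coeffMatrix R = 1 - H ∧
      ∀ r t, H r t = if simplexVerts r = {v₀} ∧ t.dim = 0 then 1 else 0 := by
    refine ⟨polyMatrix m R (coneMatrix v₀),
      (polyMatrix m R (vertexCol v₀) * polyMatrix m R (vertexRow V) :), fun r t h => ?_, ?_,
      fun r t => ?_⟩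
    · exact dim_of_coneMatrix_ne_zero (v₀ := v₀) (r := r) (t := t) fun h' => h
        ((congrArg (Int.castRingHom _) h').trans (map_zero _))
    · rw [coeffMatrix_simplex]
      exact polyMatrix_cone R hv₀
    · rw [← Matrix.map_mul]
      refine (congrArg (Int.castRingHom _) (vertexCol_mul_vertexRow_eq r t)).trans ?_
      split_ifs <;> simp
  refine (isCellularResolution_iff _).2 ⟨fun z hz => ?_, fun i z hz => ?_⟩
  · refine ⟨_, (boundary_contraction_zero hK hH z).trans ?_⟩
    rw [matrixMap_sub, matrixMap_one, LinearMap.sub_apply, LinearMap.id_apply, sub_eq_self]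
    -- With all labels `1` and a single component, the augmentation is the sum of the coefficients.
    -- Its vanishing makes `H z` vanish, so `K z` bounds `z`.
    have hs : ∑ c, z c = 0 := by
      have h1 : (simplex V m).augmentation R z =
          ∑ c, Finsupp.single ((simplex V m).componentOf (vertexPoint m v₀)) (z c) := by
        conv_lhs => rw [← Finsupp.univ_sum_single z, map_sum]
        refine Finset.sum_congr rfl fun c _ => ?_
        rw [augmentation_single', emptyFace_simplex_eq v₀
          ((simplex V m).componentOf c.1.center) ((simplex V m).componentOf (vertexPoint m v₀))]
        exact congrArg _ (mul_one _)
      rw [h1, ← Finsupp.single_finsetSum, Finsupp.single_eq_zero] at hz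
      exact hz
    refine Finsupp.ext fun d => ?_
    rw [matrixMap_apply]
    have h2 : ∀ c : (simplex V m).CellOfDim 0,
        z c * H d.1 c.1 =
          z c * if simplexVerts d.1 = {v₀} then 1 else 0 := fun c => by
      rw [hE, c.2]
      simp
    refine (Finset.sum_congr rfl fun c _ => h2 c).trans ?_
    rw [← Finset.sum_mul, hs, zero_mul]
    rfl
  -- In positive dimension `H` is zero.
  · refine ⟨_, (boundary_contraction_succ hK hH i hz).trans ?_⟩
    rw [matrixMap_sub, matrixMap_one, LinearMap.sub_apply, LinearMap.id_apply, sub_eq_self]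
    refine Finsupp.ext fun d => ?_
    rw [matrixMap_apply]
    refine Finset.sum_eq_zero fun c _ => ?_
    rw [hE, c.2]
    simp

end LabeledCellComplex

namespace LabeledCellComplex

open RegularCW CategoryTheory

/-! ### The number of cells of the product -/

section Card

variable {m : ℕ} (F : LabeledCellComplex.{u} m) {V : Type u} [LinearOrder V] [Fintype V]

variable (V) in
lemma card_cellOfDim_simplex (k : ℕ) :
    Nat.card (RegularCW.CellOfDim (RegularCW.simplex V) k) =
      (Fintype.card V).choose (k + 1) := by
  rw [← Finset.card_univ, ← Finset.card_powersetCard, ← Nat.card_eq_finsetCard]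
  refine Nat.card_congr (Equiv.ofBijective (fun c => ⟨simplexVerts c.1, ?_⟩) ⟨?_, ?_⟩)
  · rw [Finset.mem_powersetCard, card_simplexVerts, c.2]
    exact ⟨Finset.subset_univ _, rfl⟩
  · intro c d h
    exact Subtype.ext (simplexVerts_injective (congrArg Subtype.val h))
  · rintro ⟨s, hs⟩
    have hc := (Finset.mem_powersetCard.1 hs).2
    obtain ⟨c, rfl⟩ := exists_simplexVerts (Finset.card_pos.1 (by omega : 0 < s.card))
    rw [card_simplexVerts] at hc
    exact ⟨⟨c, by omega⟩, rfl⟩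

/-- The cells of the product in terms of the dimension of the second factor. -/
def cellOfDimEquiv (i : ℕ) : (F.prodSimplex V).CellOfDim i ≃
    Σ k : Fin (i + 1), RegularCW.CellOfDim (RegularCW.simplex V) k × F.CellOfDim (i - k) where
  toFun c :=
    have h : (F.pairEquiv V c.1).1.dim + (F.pairEquiv V c.1).2.dim = i :=
      (F.dim_pairEquiv V c.1).symm.trans c.2
    ⟨⟨(F.pairEquiv V c.1).2.dim, by omega⟩, ⟨(F.pairEquiv V c.1).2, rfl⟩,
      ⟨(F.pairEquiv V c.1).1, by simp only; omega⟩⟩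
  invFun p := ⟨(F.pairEquiv V).symm (p.2.2.1, p.2.1.1), by
    have h1 := p.2.1.2
    have h2 := p.2.2.2
    have h3 := p.1.2
    rw [dim_pairEquiv_symm, h1, h2]
    omega⟩
  left_inv c := Subtype.ext ((F.pairEquiv V).symm_apply_apply c.1)
  right_inv := by
    rintro ⟨⟨k, hk⟩, ⟨c, hc⟩, ⟨d, hd⟩⟩
    change c.dim = k at hc
    subst hc
    have h := (F.pairEquiv V).apply_symm_apply (d, c)
    simp only
    -- The components carry proofs about the pair being rewritten, so these are generalized before
    -- the rewriting.
    generalize_proofs h1 h2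
    revert h1 h2
    rw [h]
    intros
    rfl

variable (V) in
lemma card_cellOfDim_prodSimplex (i : ℕ) :
    Nat.card ((F.prodSimplex V).CellOfDim i) = ∑ k ∈ Finset.range (i + 1),
      (Fintype.card V).choose (k + 1) * Nat.card (F.CellOfDim (i - k)) := by
  rw [Nat.card_congr (F.cellOfDimEquiv i), Nat.card_sigma, ← Fin.sum_univ_eq_sum_range]
  refine Finset.sum_congr rfl fun k _ => ?_
  rw [Nat.card_prod, card_cellOfDim_simplex]

end Card

/-! ### Homotopies of morphisms into the factors and the product -/

section Homotopies

variable {m : ℕ} {F Z : LabeledCellComplex.{u} m} {V : Type u} [LinearOrder V] [Fintype V]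
  {R : Type w} [CommRing R]

/-- Morphisms to the simplex are homotopic, as it is contractible and so is its chain complex. -/
theorem homotopic_of_simplex {v₀ : V} (hv₀ : ∀ v, v₀ ≤ v) (f g : Morphism R Z (simplex V m)) :
    f.Homotopic g := by
  refine ⟨?_, ?_⟩
  -- The generator is sent to the vertex `v₀`, whose label is `1`. This splits the augmentation, so
  -- any difference in degree `0` factors through it.
  · let s : ((simplex V m).EmptyFace →₀ MvPolynomial (Fin m) R) →ₗ[MvPolynomial (Fin m) R]
        ((simplex V m).CellOfDim 0 →₀ MvPolynomial (Fin m) R) :=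
      Finsupp.lmapDomain _ _ fun _ => ⟨vertexCell v₀, dim_vertexCell v₀⟩
    have hs : (simplex V m).augmentation R ∘ₗ s = LinearMap.id := by
      refine Finsupp.lhom_ext' fun a => LinearMap.ext_ring ?_
      have h1 : s (Finsupp.single a 1) =
          Finsupp.single ⟨vertexCell v₀, dim_vertexCell v₀⟩ 1 := Finsupp.mapDomain_single
      rw [LinearMap.comp_apply, LinearMap.comp_apply, Finsupp.lsingle_apply, h1,
        augmentation_single]
      exact congrArg (fun b => Finsupp.single b 1) (emptyFace_simplex_eq v₀ _ _)
    refine nonempty_homotopy_of_chainZero (isCellularResolution_simplex R hv₀) _ _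
      (s ∘ₗ (chainZero R f.chain - chainZero R g.chain)) ?_
    rw [← LinearMap.comp_assoc, hs, LinearMap.id_comp]
  · have := contractibleSpace_simplex (m := m) v₀
    obtain ⟨y, hy⟩ := id_nullhomotopic (simplex V m).carrier
    -- Every map to a contractible space is homotopic to one fixed constant map.
    have h (a : C(Z.carrier, (simplex V m).carrier)) : a.Homotopic (ContinuousMap.const _ y) :=
      hy.comp (ContinuousMap.Homotopic.refl a)
    exact (h f.map).trans (h g.map).symm

/-- Chain maps to a resolution that agree in degree `0` are homotopic. -/
theorem nonempty_homotopy_of_chainZero_eq (hF : F.IsCellularResolution R)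
    {f g : Z.cellularComplex R ⟶ F.cellularComplex R} (h : chainZero R f = chainZero R g) :
    Nonempty (Homotopy f g) :=
  nonempty_homotopy_of_chainZero hF f g 0 ((sub_eq_zero.2 h).trans (LinearMap.comp_zero _).symm)

/-- A map to the product is the pair of its projections, so the two homotopies can be paired. -/
lemma homotopic_pairMap {h : C(Z.carrier, (F.prodSimplex V).carrier)} {f : C(Z.carrier, F.carrier)}
    {g : C(Z.carrier, (simplex V m).carrier)}
    (hf : ((fstMap F (simplex V m)).comp h).Homotopic f)
    (hg : ((sndMap F (simplex V m)).comp h).Homotopic g) : (pairMap f g).Homotopic h :=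
  (ContinuousMap.Homotopic.prodMk hf hg).symm

/-- In degree `0` the inclusion and the projection are given by inverse bijections of bases. -/
lemma chainZero_inclMorphism_comp_fstMorphism (v₀ : V) (f : Morphism R Z F) :
    chainZero R ((f.comp (F.inclMorphism R v₀)).comp (F.fstMorphism R v₀)).chain =
      chainZero R f.chain := by
  have h : emptyFaceLin (R := R) (F.emptyFaceEquiv (V := V) v₀) ∘ₗ
      emptyFaceLin (F.emptyFaceEquiv v₀).symm = LinearMap.id := by
    refine Finsupp.lhom_ext' fun a => LinearMap.ext_ring ?_
    rw [LinearMap.comp_apply, LinearMap.comp_apply, Finsupp.lsingle_apply, emptyFaceLin_single,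
      emptyFaceLin_single, Equiv.apply_symm_apply]
    rfl
  exact LinearMap.ext fun z => LinearMap.congr_fun h (chainZero R f.chain z)

/-- The composite is the identity in degree `0`, and the product is acyclic. On chains, a morphism
to the product can thus be recovered from its first projection. -/
lemma nonempty_homotopy_fstMorphism_inclMorphism {v₀ : V} (hv₀ : ∀ v, v₀ ≤ v)
    (hF : F.IsCellularResolution R) :
    Nonempty (Homotopy ((F.fstMorphism R v₀).chain ≫ (F.inclMorphism R v₀).chain)
      (𝟙 ((F.prodSimplex V).cellularComplex R))) := by
  refine nonempty_homotopy_of_chainZero_eq (isCellularResolution_prodSimplex hv₀ hF) ?_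
  refine Finsupp.lhom_ext' fun a => LinearMap.ext_ring ?_
  show emptyFaceLin (R := R) (F.emptyFaceEquiv v₀).symm
    (emptyFaceLin (F.emptyFaceEquiv v₀) (Finsupp.single a 1)) = Finsupp.single a 1
  rw [emptyFaceLin_single, emptyFaceLin_single, Equiv.symm_apply_apply]

/-- The product with a simplex is a product up to homotopy. -/
theorem isHomotopyProduct_prodSimplex {v₀ : V} (hv₀ : ∀ v, v₀ ≤ v)
    (hF : F.IsCellularResolution R) :
    IsHomotopyProduct (F.fstMorphism R v₀) (F.sndMorphism R v₀) := by
  intro Z _ f g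
  -- The witness ignores `g`, since its second projection is homotopic to `g` in any case.
  refine ⟨⟨f.comp (F.inclMorphism R v₀),
    ⟨nonempty_homotopy_of_chainZero_eq hF (chainZero_inclMorphism_comp_fstMorphism v₀ f),
      ContinuousMap.Homotopic.refl _⟩, homotopic_of_simplex hv₀ _ _⟩, ?_⟩
  -- The chain homotopies come from the first projection alone; the topological homotopy uses both
  -- projections.
  rintro h h' ⟨⟨e1⟩, t1⟩ ⟨-, t2⟩ ⟨⟨e1'⟩, t1'⟩ ⟨-, t2'⟩
  obtain ⟨e⟩ := nonempty_homotopy_fstMorphism_inclMorphism (V := V) hv₀ hF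
  -- On chains `k ≃ ι p k ≃ ι f`, and the last term does not depend on `k`.
  have key : ∀ k : Morphism R Z (F.prodSimplex V),
      Homotopy (k.comp (F.fstMorphism R v₀)).chain f.chain →
      Nonempty (Homotopy k.chain (f.chain ≫ (F.inclMorphism R v₀).chain)) := fun k a =>
    ⟨(Homotopy.compLeftId e k.chain).symm.trans
      ((Homotopy.ofEq (Category.assoc _ _ _).symm).trans
        (a.compRight (F.inclMorphism R v₀).chain))⟩
  obtain ⟨a⟩ := key h e1
  obtain ⟨a'⟩ := key h' e1'
  exact ⟨⟨a.trans a'.symm⟩, (homotopic_pairMap t1 t2).symm.trans (homotopic_pairMap t1' t2')⟩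

end Homotopies

end LabeledCellComplex

end

/-! ### The proposition -/

theorem mainTheorem8 {R : Type w} [CommRing R] {m : ℕ} (F : LabeledCellComplex.{u} m)
    (hF : F.IsCellularResolution R) (n : ℕ) (V : Type u) [LinearOrder V] [Fintype V]
    (hV : Fintype.card V = n + 1) :
    (LabeledCellComplex.simplex V m).IsCellularResolution R ∧
    (F.prodSimplex V).IsCellularResolution R ∧
    (∀ i : ℕ, Nat.card ((F.prodSimplex V).CellOfDim i) =
      ∑ k ∈ Finset.range (i + 1), (n + 1).choose (k + 1) * Nat.card (F.CellOfDim (i - k))) ∧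
    (∀ (i : ℕ) (b : (F.prodSimplex V).CellOfDim (i + 1))
      (a : (F.prodSimplex V).CellOfDim i),
      (F.prodSimplex V).boundary R i (Finsupp.single b 1) a =
        LabeledCellComplex.productEntry R F (LabeledCellComplex.simplex V m)
          (RegularCW.prodCellEquiv a.1) (RegularCW.prodCellEquiv b.1)) ∧
    ∃ (p : LabeledCellComplex.Morphism R (F.prodSimplex V) F)
      (q : LabeledCellComplex.Morphism R (F.prodSimplex V)
        (LabeledCellComplex.simplex V m)),
      p.map = LabeledCellComplex.fstMap F (LabeledCellComplex.simplex V m) ∧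
      q.map = LabeledCellComplex.sndMap F (LabeledCellComplex.simplex V m) ∧
      (∃ e : (F.prodSimplex V).EmptyFace ≃ F.EmptyFace,
        ∀ a, LabeledCellComplex.chainZero R p.chain (Finsupp.single a 1) =
          Finsupp.single (e a) 1) ∧
      (∀ a, ∃ b, LabeledCellComplex.chainZero R q.chain (Finsupp.single a 1) =
        Finsupp.single b 1) ∧
      LabeledCellComplex.IsHomotopyProduct p q ∧
      (∀ Z : LabeledCellComplex.{u} m, Z.IsCellularResolution R →
        ∀ (f : LabeledCellComplex.Morphism R Z F)
          (g : LabeledCellComplex.Morphism R Z (LabeledCellComplex.simplex V m)),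
          (∃ h : LabeledCellComplex.Morphism R Z (F.prodSimplex V),
            (LabeledCellComplex.pairMap f.map g.map).Homotopic h.map ∧
            LabeledCellComplex.chainZero R (h.comp p).chain =
              LabeledCellComplex.chainZero R f.chain) ∧
          ∀ h : LabeledCellComplex.Morphism R Z (F.prodSimplex V),
            (LabeledCellComplex.pairMap f.map g.map).Homotopic h.map →
            LabeledCellComplex.chainZero R (h.comp p).chain =
              LabeledCellComplex.chainZero R f.chain →
            (h.comp p).Homotopic f ∧ (h.comp q).Homotopic g) := by
  have : Nonempty V := Fintype.card_pos_iff.1 (by omega)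
  -- The apex of all cones is the least vertex, which makes the signs in the cone identity simple.
  obtain ⟨v₀, hv₀⟩ : ∃ v₀ : V, ∀ v, v₀ ≤ v := Finite.exists_min id
  refine ⟨LabeledCellComplex.isCellularResolution_simplex R hv₀,
    LabeledCellComplex.isCellularResolution_prodSimplex hv₀ hF, fun i => ?_, fun i b a => ?_,
    F.fstMorphism R v₀, F.sndMorphism R v₀, rfl, rfl,
    ⟨F.emptyFaceEquiv v₀, fun a => LabeledCellComplex.emptyFaceLin_single _ _ _⟩,
    fun a => ⟨_, LabeledCellComplex.emptyFaceLin_single _ _ _⟩,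
    LabeledCellComplex.isHomotopyProduct_prodSimplex hv₀ hF, fun Z _ f g =>
      ⟨⟨f.comp (F.inclMorphism R v₀), ?_,
        LabeledCellComplex.chainZero_inclMorphism_comp_fstMorphism v₀ f⟩, fun h hm hc => ?_⟩⟩
  · rw [LabeledCellComplex.card_cellOfDim_prodSimplex, hV]
  · rw [LabeledCellComplex.boundary_single_apply]
    exact F.coeff_prodSimplex V R a.1 b.1
  -- The inclusion at `v₀` after `f` has first component `f.map`; its second component is constant
  -- and homotopic to `g.map`, as the simplex is contractible.
  · exact LabeledCellComplex.homotopic_pairMap (ContinuousMap.Homotopic.refl _)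
      (LabeledCellComplex.homotopic_of_simplex hv₀
        ((f.comp (F.inclMorphism R v₀)).comp (F.sndMorphism R v₀)) g).2
  -- Equality in degree `0` suffices for the chain homotopy to `f`. The topological homotopy is the
  -- given one followed by the first projection.
  · exact ⟨⟨LabeledCellComplex.nonempty_homotopy_of_chainZero_eq hF hc,
      ((ContinuousMap.Homotopic.refl
        (LabeledCellComplex.fstMap F (LabeledCellComplex.simplex V m))).comp hm).symm⟩,
      LabeledCellComplex.homotopic_of_simplex hv₀ _ _⟩
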